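/- Let $M$ be a von Neumann algebra with a faithful normal normalized trace $\tau$, let $N\subset M$ be a von Neumann subalgebra, and let $E_N:M\to N$ be the $\tau$-preserving conditional expectation. Write $L^2(M)$ for the GNS space of $\tau$ and $\Omega$ for its trace vector. Assume that the inclusion is finite, i.e. there is a finite Pimsner–Popa basis $\eta_1,\dots,\eta_n\in M$, so that $\sum_j\eta_jE_N(\eta_j^*x)=x$ for all $x\in M$, and let $\delta>0$ be given by $\delta^2=[M:N]=\dim_NL^2(M)$. Let $e_N$ be the projection of $L^2(M)$ onto $\overline{N\Omega}$, let $M_1=\mathrm{End}(L^2(M)_N)$ be the basic construction with its canonical trace $\tau_1(z)=\delta^{-2}\sum_j\langle z\eta_j\Omega,\eta_j\Omega\rangle$, and write $\Omega_1$ for the trace vector of $L^2(M_1)$, the GNS space of $\tau_1$. Let $M_2=\mathrm{End}(L^2(M_1)_M)$ be the basic construction of $M\subset M_1$. Let $\Phi:M\to M$ be a completely positive $N$-$N$-bimodule map. Let $\mathcal H^{E_N}$ be the completion of $M\otimes L^2(M)$ (modulo null vectors) for $\langle a_1\otimes\xi_1,a_2\otimes\xi_2\rangle=\langle E_N(a_2^*a_1)\xi_1,\xi_2\rangle$,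 an $M$-$M$-bimodule with left action $\pi$ and cyclic vector $\Omega_{E_N}=[1\otimes\Omega]$, and let $v:L^2(M)\to\mathcal H^{E_N}$, $v\xi=[1\otimes\xi]$. Then: (a) $cE_N-\Phi$ is completely positive for some $c>0$, and there is a unique positive $h_\Phi\in\mathrm{End}({}_M\mathcal H^{E_N}{}_M)$ with $\Phi(a)=v^*\pi(a)h_\Phi v$ for all $a\in M$ (the derivative of $\Phi$ with respect to $E_N$); (b) there is a (unique) bounded operator $\widehat\Phi$ on $L^2(M)\otimes_NL^2(M)$, the Fourier multiplier of $\Phi$, with $$\widehat\Phi(x\Omega\otimes_Ny\Omega)=\delta^{-1}\sum_{j}x\eta_j\Omega\otimes_N\Phi(\eta_j^*)y\Omega,\qquad x,y\in M;$$ (c) there are unitaries $\mathcal H^{E_N}\to L^2(M)\otimes_NL^2(M)$, $x\Omega_{E_N}y\mapsto x\Omega\otimes_Ny\Omega$, and $L^2(M_1)\to L^2(M)\otimes_NL^2(M)$, $\delta\,xe_Ny\Omega_1\mapsto x\Omega\otimes_Ny\Omega$, and conjugation by them identifies $\mathrm{End}({}_M\mathcal H^{E_N}{}_M)$, $\mathrm{End}({}_ML^2(M)\otimes_NL^2(M)_M)$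 and $M'\cap M_2$; (d) under these identifications, $h_\Phi=\delta\,\widehat\Phi$ in $M'\cap M_2$. -/

import Mathlib

open scoped InnerProductSpace CStarAlgebra ComplexOrder

universe u

noncomputable section

/-! ### Von Neumann algebras as C⋆-algebras -/

section VonNeumann

variable {H : Type u} [NormedAddCommGroup H] [InnerProductSpace ℂ H] [CompleteSpace H]

instance VonNeumannAlgebra.instSMulMemClass :
    SMulMemClass (VonNeumannAlgebra H) ℂ (H →L[ℂ] H) where
  smul_mem {S} c _ hx := S.toStarSubalgebra.smul_mem hx c

instance VonNeumannAlgebra.instIsClosed (M : VonNeumannAlgebra H) :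
    IsClosed (M : Set (H →L[ℂ] H)) := by
  rw [← M.centralizer_centralizer]
  exact Set.isClosed_centralizer _

/-- The operator order restricted to a von Neumann algebra is its C⋆-algebra order. -/
instance VonNeumannAlgebra.instStarOrderedRing (M : VonNeumannAlgebra H) : StarOrderedRing M :=
  StarOrderedRing.of_le_iff fun x y => by
    constructor
    · intro h
      have h0 : 0 ≤ ((y : H →L[ℂ] H) - x) := sub_nonneg.mpr h
      refine ⟨⟨CFC.sqrt ((y : H →L[ℂ] H) - x), ?_⟩, ?_⟩
      · rw [CFC.sqrt_eq_real_sqrt _ h0]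
        exact cfcₙ_mem (𝕜' := ℂ) (s := M) _ (sub_mem y.2 x.2)
      · apply Subtype.ext
        have h1 : star (CFC.sqrt ((y : H →L[ℂ] H) - x)) = CFC.sqrt ((y : H →L[ℂ] H) - x) :=
          (IsSelfAdjoint.of_nonneg (CFC.sqrt_nonneg _)).star_eq
        change (y : H →L[ℂ] H) =
          x + star (CFC.sqrt ((y : H →L[ℂ] H) - x)) * CFC.sqrt ((y : H →L[ℂ] H) - x)
        rw [h1, CFC.sqrt_mul_sqrt_self _ h0]
        abel
    · rintro ⟨s, rfl⟩
      change (x : H →L[ℂ] H) ≤ x + star (s : H →L[ℂ] H) * s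
      exact le_add_of_nonneg_right (star_mul_self_nonneg _)

namespace Subfactor

variable (H) in
/-- The ultraweak (σ-weak) topology on `B(H)`: the coarsest one making every functional
`x ↦ ∑ₙ ⟪ξₙ, x ηₙ⟫` with square-summable `ξ`, `η` continuous. -/
@[reducible]
def ultraweakTopology : TopologicalSpace (H →L[ℂ] H) :=
  ⨅ (ξ : lp (fun _ : ℕ => H) 2) (η : lp (fun _ : ℕ => H) 2),
    TopologicalSpace.induced (fun x : H →L[ℂ] H => ∑' n, ⟪ξ n, x (η n)⟫_ℂ) inferInstance

/-- `τ` is a faithful normal normalized trace on the von Neumann algebra `M`. -/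
structure IsFaithfulNormalTrace (M : VonNeumannAlgebra H) (τ : M →ₚ[ℂ] ℂ) : Prop where
  normalized : τ 1 = 1
  tracial : ∀ x y : M, τ (x * y) = τ (y * x)
  faithful : ∀ x : M, τ (star x * x) = 0 → x = 0
  normal : @Continuous M ℂ
    (TopologicalSpace.induced (fun x : M => (x : H →L[ℂ] H)) (ultraweakTopology H)) inferInstance τ

/-- The von Neumann subalgebra `N`, seen as a subset of `M`. -/
def subIn (M N : VonNeumannAlgebra H) : Set M := {x | (x : H →L[ℂ] H) ∈ N}

/-- The commutant of `S ∪ S*`, as a von Neumann algebra. -/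
def commutantOf (S : Set (H →L[ℂ] H)) : VonNeumannAlgebra H where
  toStarSubalgebra := StarSubalgebra.centralizer ℂ S
  centralizer_centralizer' := by
    change Set.centralizer (Set.centralizer (StarSubalgebra.centralizer ℂ S : Set (H →L[ℂ] H))) =
      (StarSubalgebra.centralizer ℂ S : Set (H →L[ℂ] H))
    rw [StarSubalgebra.coe_centralizer, Set.centralizer_centralizer_centralizer]

end Subfactor

end VonNeumann

namespace Subfactor

/-! ### Operators prescribed on a total set, and Hilbert spaces generated by a kernel -/

/-- The bounded operator `T` with `T (f v) = g v` for all `v` (unique as soon as the vectors `f v`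
span a dense subspace; `0` if there is no bounded operator of this kind). -/
def boundedExt {ι H₁ H₂ : Type*} [NormedAddCommGroup H₁] [InnerProductSpace ℂ H₁]
    [NormedAddCommGroup H₂] [InnerProductSpace ℂ H₂] (f : ι → H₁) (g : ι → H₂) : H₁ →L[ℂ] H₂ :=
  open Classical in if h : ∃ T : H₁ →L[ℂ] H₂, ∀ v, T (f v) = g v then h.choose else 0

/-- `T` commutes with the left action `L` and with the right action `R`. -/
def bimoduleEnd {A B H : Type*} [NormedAddCommGroup H] [InnerProductSpace ℂ H]
    (L : A → H →L[ℂ] H) (R : B → H →L[ℂ] H) : Set (H →L[ℂ] H) :=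
  {T | (∀ a, Commute (L a) T) ∧ (∀ b, Commute (R b) T)}

section Kernel

variable {X V : Type*} [NormedAddCommGroup V] [InnerProductSpace ℂ V] [CompleteSpace V]

/-- `k` itself when `k` is positive semidefinite; a harmless value otherwise. -/
def psdKernel (k : Matrix X X (V →L[ℂ] V)) : Matrix X X (V →L[ℂ] V) :=
  open Classical in if k.PosSemidef then k else 0

instance (k : Matrix X X (V →L[ℂ] V)) : Fact (psdKernel k).PosSemidef := by
  constructor
  unfold psdKernel
  split_ifs with h
  · exact h
  · exact Matrix.PosSemidef.zero

/-- The Hilbert space generated by symbols `x ⊗ ξ`, linear in `ξ ∈ V`, with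
`⟪x ⊗ ξ, y ⊗ η⟫ = ⟪ξ, k x y η⟫` (separation and completion of the span of the symbols),
for a positive semidefinite operator-valued kernel `k`. -/
abbrev KernelSpace (k : Matrix X X (V →L[ℂ] V)) := RKHS.OfKernel (psdKernel k)

/-- The class of the symbol `x ⊗ ξ`. -/
def symb (k : Matrix X X (V →L[ℂ] V)) (x : X) : V →L[ℂ] KernelSpace k :=
  RKHS.kerFun (KernelSpace k) x

theorem inner_symb {k : Matrix X X (V →L[ℂ] V)} (hk : k.PosSemidef) (x y : X) (ξ η : V) :
    ⟪symb k x ξ, symb k y η⟫_ℂ = ⟪ξ, k x y η⟫_ℂ := by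
  have h : psdKernel k = k := if_pos hk
  unfold symb
  rw [RKHS.kerFun_inner, RKHS.kerFun_apply, RKHS.OfKernel.kernel_ofKernel, h]

end Kernel

/-! ### The standard representation -/

section Standard

variable {A : Type u} [CStarAlgebra A] [PartialOrder A] [StarOrderedRing A] (τ : A →ₚ[ℂ] ℂ)

/-- `L²(A, τ)`, the GNS space of `τ`. -/
abbrev L2 := τ.GNS

/-- The vector `aΩ ∈ L²(A, τ)`. -/
def vec (a : A) : L2 τ := ((τ.toPreGNS a : τ.PreGNS) : τ.GNS)

/-- The left action of `A` on `L²(A, τ)`. -/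
abbrev leftMul (a : A) : L2 τ →L[ℂ] L2 τ := τ.gnsStarAlgHom a

/-- The right action of `A` on `L²(A, τ)` for a tracial `τ`: the extension of `aΩ ↦ abΩ`. -/
def rightMul (b : A) : L2 τ →L[ℂ] L2 τ := boundedExt (fun a => vec τ a) (fun a => vec τ (a * b))

theorem leftMul_vec (a b : A) : leftMul τ a (vec τ b) = vec τ (a * b) := by
  simp [vec, leftMul, PositiveLinearMap.gnsNonUnitalStarAlgHom_apply_coe]

theorem denseRange_vec : DenseRange (vec τ) :=
  UniformSpace.Completion.denseRange_coe.comp τ.toPreGNS.surjective.denseRange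
    (UniformSpace.Completion.continuous_coe _)

theorem rightMul_eq_zero_or (b : A) :
    rightMul τ b = 0 ∨ ∀ a, rightMul τ b (vec τ a) = vec τ (a * b) := by
  unfold rightMul boundedExt
  split_ifs with h
  · exact Or.inr h.choose_spec
  · exact Or.inl rfl

theorem leftMul_commute_rightMul (a b : A) : Commute (leftMul τ a) (rightMul τ b) := by
  rcases rightMul_eq_zero_or τ b with h | h
  · rw [h]; exact Commute.zero_right _
  · change leftMul τ a * rightMul τ b = rightMul τ b * leftMul τ a
    apply ContinuousLinearMap.coeFn_injective
    apply (denseRange_vec τ).equalizer (ContinuousLinearMap.continuous _)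
      (ContinuousLinearMap.continuous _)
    funext c
    simp [h, leftMul_vec, mul_assoc, -PositiveLinearMap.gnsStarAlgHom_apply]

/-! ### Conditional expectation, index, basic construction

`S` is the subalgebra, given as a subset of `A`. -/

variable (S : Set A)

/-- `E` is the trace-preserving conditional expectation of `A` onto `S`. -/
structure IsCondExp (E : A →ₗ[ℂ] A) : Prop where
  mem : ∀ x, E x ∈ S
  proj : ∀ x ∈ S, E x = x
  pos : ∀ x, 0 ≤ x → 0 ≤ E x
  bimodule : ∀ a ∈ S, ∀ b ∈ S, ∀ x, E (a * x * b) = a * E x * b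
  trace : ∀ x, τ (E x) = τ x

/-- The trace-preserving conditional expectation `E_S`. -/
def condExp : A →ₗ[ℂ] A :=
  open Classical in if h : ∃ E, IsCondExp τ S E then h.choose else 0

/-- `η` is a finite Pimsner–Popa basis: `∑ⱼ ηⱼ E(ηⱼ* x) = x` for all `x`. -/
def IsPimsnerPopaBasis {n : ℕ} (η : Fin n → A) : Prop :=
  ∀ x, ∑ j, η j * condExp τ S (star (η j) * x) = x

/-- `L²(S)` as the closed subspace of `L²(A, τ)` generated by `SΩ`. -/
def L2Sub : Submodule ℂ (L2 τ) := (Submodule.span ℂ (vec τ '' S)).topologicalClosure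

/-- The Jones projection, the orthogonal projection of `L²(A, τ)` onto `L²(S)`. -/
def jonesProj : L2 τ →L[ℂ] L2 τ :=
  haveI : CompleteSpace (L2Sub τ S) :=
    (Submodule.isClosed_topologicalClosure _).completeSpace_coe
  (L2Sub τ S).starProjection

/-- `d` is the von Neumann dimension of the right `S`-module `L²(A, τ)`: there is an isometric
right `S`-module map `V` of `L²(A, τ)` into `L²(S)^k`, and `d` is the trace
`∑ᵢ ⟪V V* Ωᵢ, Ωᵢ⟫ = ∑ᵢ ‖V* Ωᵢ‖²` of its range projection, where `Ωᵢ` is `Ω` in the `i`-th place. -/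
def IsModuleDim (d : ℝ) : Prop :=
  ∃ (k : ℕ) (V : L2 τ →ₗᵢ[ℂ] PiLp 2 (fun _ : Fin k => L2 τ)),
    (∀ ξ i, V ξ i ∈ L2Sub τ S) ∧
    (∀ b ∈ S, ∀ ξ i, V (rightMul τ b ξ) i = rightMul τ b (V ξ i)) ∧
    d = ∑ i, ‖ContinuousLinearMap.adjoint V.toContinuousLinearMap
      (PiLp.single 2 i (vec τ 1))‖ ^ 2

/-- The Jones index `[A : S] = dim_S L²(A, τ)` (the dimension does not depend on the embedding,
so the infimum is over one value when `L²(A, τ)` is finitely generated). -/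
def jonesIndex : ℝ := sInf {d | IsModuleDim τ S d}

/-- `δ`, the square root of the Jones index. -/
def delta : ℝ := √(jonesIndex τ S)

/-- The basic construction: the von Neumann algebra `End(L²(A, τ)_S)` of operators commuting
with the right action of `S`, i.e. `J S' J`. -/
def basicConstruction : VonNeumannAlgebra (L2 τ) := commutantOf (rightMul τ '' S)

theorem leftMul_mem_basicConstruction (a : A) : leftMul τ a ∈ basicConstruction τ S := by
  have key : ∀ b a', leftMul τ a' * rightMul τ b = rightMul τ b * leftMul τ a' :=
    fun b a' => leftMul_commute_rightMul τ a' b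
  change leftMul τ a ∈ StarSubalgebra.centralizer ℂ (rightMul τ '' S)
  rw [StarSubalgebra.mem_centralizer_iff]
  rintro _ ⟨b, -, rfl⟩
  refine ⟨(key b a).symm, ?_⟩
  have h := congrArg star (key b (star a))
  simpa only [star_mul, leftMul, map_star, star_star] using h

/-- The inclusion of `A` into its basic construction. -/
def incl (a : A) : basicConstruction τ S := ⟨leftMul τ a, leftMul_mem_basicConstruction τ S a⟩

/-- The canonical trace `z ↦ δ⁻² ∑ⱼ ⟪z ηⱼΩ, ηⱼΩ⟫` on the basic construction. -/
def canonicalTrace {n : ℕ} (η : Fin n → A) : basicConstruction τ S →ₚ[ℂ] ℂ :=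
  PositiveLinearMap.mk₀
    { toFun := fun z => (((jonesIndex τ S)⁻¹ : ℝ) : ℂ) *
        ∑ j, ⟪vec τ (η j), (z : L2 τ →L[ℂ] L2 τ) (vec τ (η j))⟫_ℂ
      map_add' := fun z w => by
        have h : ∀ j, ⟪vec τ (η j), ((z + w : basicConstruction τ S) : L2 τ →L[ℂ] L2 τ)
            (vec τ (η j))⟫_ℂ = ⟪vec τ (η j), (z : L2 τ →L[ℂ] L2 τ) (vec τ (η j))⟫_ℂ +
              ⟪vec τ (η j), (w : L2 τ →L[ℂ] L2 τ) (vec τ (η j))⟫_ℂ :=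
          fun j => inner_add_right _ _ _
        simp only [h, Finset.sum_add_distrib, mul_add]
      map_smul' := fun c z => by
        have h : ∀ j, ⟪vec τ (η j), ((c • z : basicConstruction τ S) : L2 τ →L[ℂ] L2 τ)
            (vec τ (η j))⟫_ℂ = c * ⟪vec τ (η j), (z : L2 τ →L[ℂ] L2 τ) (vec τ (η j))⟫_ℂ :=
          fun j => inner_smul_right _ _ _
        simp only [h, ← Finset.mul_sum, RingHom.id_apply, smul_eq_mul, mul_left_comm] }
    fun z hz => by
      have hδ : 0 ≤ jonesIndex τ S := Real.sInf_nonneg (by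
        rintro d ⟨k, V, -, -, rfl⟩
        positivity)
      have hz' : (0 : L2 τ →L[ℂ] L2 τ) ≤ z := hz
      refine mul_nonneg (Complex.zero_le_real.mpr (inv_nonneg.mpr hδ))
        (Finset.sum_nonneg fun j _ => ?_)
      exact ((ContinuousLinearMap.nonneg_iff_isPositive _).mp hz').inner_nonneg_right _

/-! ### The relative tensor product `L²(A) ⊗_S L²(A)` -/

/-- The right `S`-bounded vectors of `L²(A, τ)`: those for which `L(ξ) : bΩ ↦ ξ b`, `b ∈ S`,
is bounded. -/
def boundedVectors : Set (L2 τ) :=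
  {ξ | ∃ c : ℝ, ∀ b ∈ S, ‖rightMul τ b ξ‖ ≤ c * ‖vec τ b‖}

theorem leftMul_mem_boundedVectors (a : A) {ξ : L2 τ} (hξ : ξ ∈ boundedVectors τ S) :
    leftMul τ a ξ ∈ boundedVectors τ S := by
  obtain ⟨c, hc⟩ := hξ
  refine ⟨‖leftMul τ a‖ * c, fun b hb => ?_⟩
  have h : rightMul τ b (leftMul τ a ξ) = leftMul τ a (rightMul τ b ξ) :=
    (DFunLike.congr_fun (leftMul_commute_rightMul τ a b).eq ξ).symm
  rw [h, mul_assoc]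
  exact (ContinuousLinearMap.le_opNorm _ _).trans
    (mul_le_mul_of_nonneg_left (hc b hb) (norm_nonneg _))

theorem vec_mem_boundedVectors (a : A) : vec τ a ∈ boundedVectors τ S := by
  have h1 : vec τ 1 ∈ boundedVectors τ S := by
    refine ⟨1, fun b _ => ?_⟩
    rcases rightMul_eq_zero_or τ b with h | h
    · simp [h]
    · simp [h]
  simpa only [leftMul_vec, mul_one] using leftMul_mem_boundedVectors τ S a h1

/-- The `S`-valued inner product of bounded vectors: the `n ∈ S` with `L(ξ)* L(ζ) = n` as
operators on `L²(S)`. -/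
def subInner (ξ ζ : L2 τ) : A :=
  open Classical in
  if h : ∃ n ∈ S, ∀ b ∈ S, ∀ c ∈ S,
      ⟪rightMul τ b ξ, rightMul τ c ζ⟫_ℂ = ⟪vec τ b, vec τ (n * c)⟫_ℂ
  then h.choose else 0

/-- `⟪ξ₁ ⊗ ζ₁, ξ₂ ⊗ ζ₂⟫ = ⟪ζ₁, (L(ξ₁)* L(ξ₂)) ζ₂⟫` (conjugate-linear in the first variable). -/
def tensorKernel : Matrix (boundedVectors τ S) (boundedVectors τ S) (L2 τ →L[ℂ] L2 τ) :=
  Matrix.of fun ξ₁ ξ₂ => leftMul τ (subInner τ S ξ₁ ξ₂)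

/-- The relative tensor product `L²(A) ⊗_S L²(A)`. -/
abbrev RelTensor := KernelSpace (tensorKernel τ S)

/-- `ξ ⊗_S ζ` for a right `S`-bounded vector `ξ`. -/
def tmul (ξ : boundedVectors τ S) (ζ : L2 τ) : RelTensor τ S := symb (tensorKernel τ S) ξ ζ

/-- `xΩ ⊗_S yΩ`. -/
def tvec (x y : A) : RelTensor τ S := tmul τ S ⟨vec τ x, vec_mem_boundedVectors τ S x⟩ (vec τ y)

/-- The left action `ξ ⊗ ζ ↦ aξ ⊗ ζ`. -/
def tensorLeft (a : A) : RelTensor τ S →L[ℂ] RelTensor τ S :=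
  boundedExt (fun p : boundedVectors τ S × L2 τ => tmul τ S p.1 p.2)
    (fun p => tmul τ S ⟨leftMul τ a p.1, leftMul_mem_boundedVectors τ S a p.1.2⟩ p.2)

/-- The right action `ξ ⊗ ζ ↦ ξ ⊗ ζb`. -/
def tensorRight (b : A) : RelTensor τ S →L[ℂ] RelTensor τ S :=
  boundedExt (fun p : boundedVectors τ S × L2 τ => tmul τ S p.1 p.2)
    (fun p => tmul τ S p.1 (rightMul τ b p.2))

/-! ### The Fourier multiplier -/

/-- The basis formula
`F (xΩ ⊗ yΩ) = δ⁻¹ ∑ⱼ xηⱼΩ ⊗ Φ(ηⱼ*) yΩ` that defines the Fourier multiplier of `Φ`. -/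
def IsFourierMultiplier {n : ℕ} (η : Fin n → A) (Φ : A →ₗ[ℂ] A)
    (F : RelTensor τ S →L[ℂ] RelTensor τ S) : Prop :=
  ∀ x y, F (tvec τ S x y) =
    ((delta τ S)⁻¹ : ℂ) • ∑ j, tvec τ S (x * η j) (Φ (star (η j)) * y)

/-- The Fourier multiplier `Φ̂` of `Φ`. -/
def fourierMultiplier {n : ℕ} (η : Fin n → A) (Φ : A →ₗ[ℂ] A) :
    RelTensor τ S →L[ℂ] RelTensor τ S :=
  boundedExt (fun p : A × A => tvec τ S p.1 p.2)
    (fun p => ((delta τ S)⁻¹ : ℂ) • ∑ j, tvec τ S (p.1 * η j) (Φ (star (η j)) * p.2))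

/-- `M' ∩ M₂`, where `M₂` is the basic construction of `M ⊂ M₁`, acting on `L²(M₁)`, and `M₁` is
the basic construction of `S ⊂ M`. -/
def relativeCommutant {n : ℕ} (η : Fin n → A) :
    Set (L2 (canonicalTrace τ S η) →L[ℂ] L2 (canonicalTrace τ S η)) :=
  {T | T ∈ basicConstruction (canonicalTrace τ S η) (Set.range (incl τ S)) ∧
    ∀ a, Commute (leftMul (canonicalTrace τ S η) (incl τ S a)) T}

end Standard

/-! ### Connes correspondence and derivative of completely positive maps -/

section Correspondence

variable {A B : Type u} [CStarAlgebra A] [PartialOrder A] [StarOrderedRing A]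
  [CStarAlgebra B] [PartialOrder B] [StarOrderedRing B] (τ : B →ₚ[ℂ] ℂ)

/-- `Φ` is majorized by `Ψ`: `cΨ - Φ` is completely positive for some `c > 0`. -/
def Majorized (Φ Ψ : A →ₗ[ℂ] B) : Prop :=
  ∃ c : ℝ, 0 < c ∧ ∃ Θ : A →CP B, Θ.toLinearMap = (c : ℂ) • Ψ - Φ

/-- `⟪a₁ ⊗ ξ₁, a₂ ⊗ ξ₂⟫ = ⟪ξ₁, Ψ(a₁* a₂) ξ₂⟫` (conjugate-linear in the first variable). -/
def corrKernel (Ψ : A →ₗ[ℂ] B) : Matrix A A (L2 τ →L[ℂ] L2 τ) :=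
  Matrix.of fun a₁ a₂ => leftMul τ (Ψ (star a₁ * a₂))

/-- The Hilbert space `H^Ψ` of the correspondence of `Ψ`, completing `A ⊗ L²(B, τ)`. -/
abbrev Corr (Ψ : A →ₗ[ℂ] B) := KernelSpace (corrKernel τ Ψ)

/-- The left action `π_Ψ(a) [a₀ ⊗ ξ] = [a a₀ ⊗ ξ]`. -/
def corrLeft (Ψ : A →ₗ[ℂ] B) (a : A) : Corr τ Ψ →L[ℂ] Corr τ Ψ :=
  boundedExt (fun p : A × L2 τ => symb (corrKernel τ Ψ) p.1 p.2)
    (fun p => symb (corrKernel τ Ψ) (a * p.1) p.2)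

/-- The right action `[a₀ ⊗ ξ] ↦ [a₀ ⊗ ξb]`. -/
def corrRight (Ψ : A →ₗ[ℂ] B) (b : B) : Corr τ Ψ →L[ℂ] Corr τ Ψ :=
  boundedExt (fun p : A × L2 τ => symb (corrKernel τ Ψ) p.1 p.2)
    (fun p => symb (corrKernel τ Ψ) p.1 (rightMul τ b p.2))

/-- The intertwiner `v_Ψ ξ = [1 ⊗ ξ]`. -/
def corrV (Ψ : A →ₗ[ℂ] B) : L2 τ →L[ℂ] Corr τ Ψ := symb (corrKernel τ Ψ) 1

/-- The cyclic vector `Ω_Ψ = [1 ⊗ Ω]`. -/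
def corrVec (Ψ : A →ₗ[ℂ] B) : Corr τ Ψ := corrV τ Ψ (vec τ 1)

/-- `End(_A H^Ψ_B)`. -/
def corrEnd (Ψ : A →ₗ[ℂ] B) : Set (Corr τ Ψ →L[ℂ] Corr τ Ψ) :=
  bimoduleEnd (corrLeft τ Ψ) (corrRight τ Ψ)

/-- `h` is a positive element of `End(_A H^Ψ_B)` with `Φ(a) = v_Ψ* π_Ψ(a) h v_Ψ` for all `a`. -/
structure IsDerivative (Φ Ψ : A →ₗ[ℂ] B) (h : Corr τ Ψ →L[ℂ] Corr τ Ψ) : Prop where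
  mem : h ∈ corrEnd τ Ψ
  nonneg : 0 ≤ h
  implements : ∀ a, leftMul τ (Φ a) =
    ContinuousLinearMap.adjoint (corrV τ Ψ) ∘L corrLeft τ Ψ a ∘L h ∘L corrV τ Ψ

/-- The derivative `h_{Φ,Ψ}` of `Φ` with respect to `Ψ`. -/
def derivative (Φ Ψ : A →ₗ[ℂ] B) : Corr τ Ψ →L[ℂ] Corr τ Ψ :=
  open Classical in if h : ∃! h, IsDerivative τ Φ Ψ h then h.choose else 0

end Correspondence

end Subfactor

end

open Subfactor

/-! A Pimsner–Popa basis reduces everything to finite matrices. Inserting `∑ⱼ ηⱼ E(ηⱼ* y) = y` into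
`E(x* y)` gives the Parseval identity `E(x* y) = ∑ₖ E(ηₖ* x)* E(ηₖ* y)` (`condExp_star_mul`). Hence
`[x ⊗ ξ] ↦ (E(ηₖ* x) ξ)ₖ` embeds `H^E` isometrically into `L²(M)ⁿ` (`exists_model`), where the
actions are given by operator matrices and are therefore bounded.

Bimodularity of `Φ` gives `Φ(x* y) = ∑ₖₗ E(ηₖ* x)* Q(k,l) E(ηₗ* y)` with `Q(k,l) = Φ(ηₖ* ηₗ)`, and
complete positivity makes `Q` positive. A bound `Q ≤ c` shows that `cE - Φ` is completely positive
(`majorized`). A factorization `Q = D* D` gives the derivative as `G* G`, where `G` is `D` after the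
embedding (`exists_derivative`). Its matrix coefficients must be `⟪ξ, Φ(x* y) ζ⟫`, so it is unique;
comparing coefficients gives `h[x ⊗ ξ] = ∑ⱼ [xηⱼ ⊗ Φ(ηⱼ*) ξ]`, which is `δ` times the formula that
defines the multiplier.

The unitaries come from equality of Gram matrices: on both `H^E` and `L²(M) ⊗_N L²(M)` the entries
are `τ(y* E(x* x') y')`, and on `L²(M₁)` the vectors `x e y Ω₁` give `δ⁻²` times this. That the
families are total rests on one analytic fact, `IsFaithfulNormalTrace.exists_vec_eq`: a bounded
vector of `L²(M)` is `aΩ` with `a ∈ M`. With it the relative tensor product is generated by the `xΩ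
⊗ ξ`, and every element of `M₁` is a finite sum `∑ⱼ mⱼ e ηⱼ*` (`exists_eq_sum_jonesMul`). Of the
index only its positivity is needed. -/

noncomputable section

namespace Subfactor

/-! ### Operators prescribed on total families -/

section Total

variable {ι H₁ H₂ H₃ : Type*} [NormedAddCommGroup H₁] [InnerProductSpace ℂ H₁]
    [NormedAddCommGroup H₂] [InnerProductSpace ℂ H₂]
    [NormedAddCommGroup H₃] [InnerProductSpace ℂ H₃]

/-- The linear span of the family `f` is dense. -/
def IsTotal (f : ι → H₁) : Prop := Dense (Submodule.span ℂ (Set.range f) : Set H₁)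

theorem IsTotal.denseRange_linearCombination {f : ι → H₁} (hf : IsTotal f) :
    DenseRange (Finsupp.linearCombination ℂ f) := by
  have h : Set.range (Finsupp.linearCombination ℂ f) = Submodule.span ℂ (Set.range f) := by
    rw [← Finsupp.range_linearCombination]; rfl
  rw [DenseRange, h]
  exact hf

theorem _root_.DenseRange.isTotal {f : ι → H₁} (hf : DenseRange f) : IsTotal f :=
  hf.mono Submodule.subset_span

theorem IsTotal.ext {f : ι → H₁} (hf : IsTotal f) {S T : H₁ →L[ℂ] H₂}
    (h : ∀ i, S (f i) = T (f i)) : S = T :=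
  ContinuousLinearMap.ext_on hf (by rintro _ ⟨i, rfl⟩; exact h i)

theorem IsTotal.ext_inner {f : ι → H₁} (hf : IsTotal f) {x y : H₁}
    (h : ∀ i, ⟪f i, x⟫_ℂ = ⟪f i, y⟫_ℂ) : x = y := by
  have h1 : innerSL ℂ x = innerSL ℂ y := hf.ext fun i => by
    rw [innerSL_apply_apply, innerSL_apply_apply, ← inner_conj_symm, h i, inner_conj_symm]
  exact ext_inner_right ℂ fun v => DFunLike.congr_fun h1 v

/-- The squared norm of a linear combination depends only on its coefficients and the Gram matrix.
-/
theorem norm_linearCombination_eq {f : ι → H₁} {g : ι → H₂}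
    (h : ∀ i j, ⟪f i, f j⟫_ℂ = ⟪g i, g j⟫_ℂ) (c : ι →₀ ℂ) :
    ‖Finsupp.linearCombination ℂ g c‖ = ‖Finsupp.linearCombination ℂ f c‖ := by
  have key : ⟪Finsupp.linearCombination ℂ g c, Finsupp.linearCombination ℂ g c⟫_ℂ =
      ⟪Finsupp.linearCombination ℂ f c, Finsupp.linearCombination ℂ f c⟫_ℂ := by
    simp only [Finsupp.linearCombination_apply, Finsupp.sum_inner, Finsupp.inner_sum,
      inner_smul_left, inner_smul_right, h]
  rw [@norm_eq_sqrt_re_inner ℂ, @norm_eq_sqrt_re_inner ℂ, key]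

/-- Two families with the same Gram matrix, the first of them total, are related by an isometry. -/
theorem IsTotal.exists_linearIsometry [CompleteSpace H₂] {f : ι → H₁} {g : ι → H₂}
    (hf : IsTotal f) (h : ∀ i j, ⟪f i, f j⟫_ℂ = ⟪g i, g j⟫_ℂ) :
    ∃ V : H₁ →ₗᵢ[ℂ] H₂, ∀ i, V (f i) = g i := by
  have hn := norm_linearCombination_eq h
  have hd := hf.denseRange_linearCombination
  let T := LinearMap.extendOfNorm (Finsupp.linearCombination ℂ g) (Finsupp.linearCombination ℂ f)
  have hT : ∀ c, T (Finsupp.linearCombination ℂ f c) = Finsupp.linearCombination ℂ g c :=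
    LinearMap.extendOfNorm_eq hd ⟨1, fun c => by rw [one_mul, hn]⟩
  refine ⟨⟨T.toLinearMap, fun x => ?_⟩, fun i => ?_⟩
  · refine hd.induction (P := fun x => ‖T x‖ = ‖x‖) ?_ (isClosed_eq (by fun_prop) (by fun_prop)) x
    rintro _ ⟨c, rfl⟩
    rw [hT, hn]
  · simpa using hT (Finsupp.single i 1)

/-- Two total families with the same Gram matrix are related by a unitary. -/
theorem IsTotal.exists_linearIsometryEquiv [CompleteSpace H₁] [CompleteSpace H₂]
    {f : ι → H₁} {g : ι → H₂} (hf : IsTotal f) (hg : IsTotal g)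
    (h : ∀ i j, ⟪f i, f j⟫_ℂ = ⟪g i, g j⟫_ℂ) :
    ∃ V : H₁ ≃ₗᵢ[ℂ] H₂, ∀ i, V (f i) = g i := by
  obtain ⟨V, hV⟩ := hf.exists_linearIsometry h
  obtain ⟨W, hW⟩ := hg.exists_linearIsometry fun i j => (h i j).symm
  have hVW : V.toContinuousLinearMap ∘L W.toContinuousLinearMap = .id ℂ H₂ :=
    hg.ext fun i => by simp [hV, hW]
  exact ⟨LinearIsometryEquiv.ofSurjective V fun y => ⟨W y, DFunLike.congr_fun hVW y⟩, hV⟩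

theorem boundedExt_apply {f : ι → H₁} {g : ι → H₂} (h : ∃ T : H₁ →L[ℂ] H₂, ∀ v, T (f v) = g v)
    (v : ι) : boundedExt f g (f v) = g v := by
  unfold boundedExt
  rw [dif_pos h]
  exact h.choose_spec v

/-- An operator prescribed on a family exists if it does so in a space containing the given one. -/
theorem exists_of_linearIsometry [CompleteSpace H₁] [CompleteSpace H₂] {f g : ι → H₁}
    (V : H₁ →ₗᵢ[ℂ] H₂) (T : H₂ →L[ℂ] H₂) (h : ∀ i, T (V (f i)) = V (g i)) :
    ∃ T : H₁ →L[ℂ] H₁, ∀ i, T (f i) = g i := by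
  -- The compression `V* T V` sends `f i` to `V* V (g i) = g i`.
  refine ⟨ContinuousLinearMap.adjoint V.toContinuousLinearMap ∘L T ∘L V.toContinuousLinearMap,
    fun i => ext_inner_right ℂ fun v => ?_⟩
  simp [ContinuousLinearMap.adjoint_inner_left, h]

theorem IsTotal.adjoint_eq [CompleteSpace H₁] {f : ι → H₁} (hf : IsTotal f) {S T : H₁ →L[ℂ] H₁}
    (h : ∀ i j, ⟪f i, S (f j)⟫_ℂ = ⟪T (f i), f j⟫_ℂ) : ContinuousLinearMap.adjoint T = S :=
  hf.ext fun j => hf.ext_inner fun i => by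
    rw [ContinuousLinearMap.adjoint_inner_right, h]

theorem IsTotal.commute {f : ι → H₁} (hf : IsTotal f) {S T : H₁ →L[ℂ] H₁}
    (h : ∀ i, S (T (f i)) = T (S (f i))) : Commute S T :=
  hf.ext h

end Total

/-! ### Totality of symbols and positive semidefinite kernels -/

section KernelSpaceLemmas

variable {X V : Type*} [NormedAddCommGroup V] [InnerProductSpace ℂ V] [CompleteSpace V]

theorem isTotal_symb (k : Matrix X X (V →L[ℂ] V)) :
    IsTotal fun p : X × V => symb k p.1 p.2 := by
  have h := RKHS.kerFun_dense (KernelSpace k)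
  rw [← Submodule.dense_iff_topologicalClosure_eq_top] at h
  have hs : Set.range (fun p : X × V => symb k p.1 p.2) =
      {RKHS.kerFun (KernelSpace k) x v | (x) (v)} := by
    ext v
    simp [symb]
  rw [IsTotal, hs]
  exact h

/-- The quadratic form of such a kernel is `∑ₖ wₖ* wₖ` with `wₖ = ∑ᵢ c(k,i) xᵢ`. -/
theorem posSemidef_sum_star_mul {R ι' : Type*} [Fintype ι'] [Ring R] [StarRing R] [PartialOrder R]
    [StarOrderedRing R] (c : ι' → X → R) :
    (Matrix.of fun i j => ∑ k, star (c k i) * c k j : Matrix X X R).PosSemidef := by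
  refine ⟨?_, fun x => ?_⟩
  · ext i j
    simp [Matrix.conjTranspose_apply, star_sum]
  · have h : (x.sum fun i xi => x.sum fun j xj =>
        star xi * (Matrix.of fun i j => ∑ k, star (c k i) * c k j : Matrix X X R) i j * xj) =
        ∑ k, star (x.sum fun i xi => c k i * xi) * (x.sum fun i xi => c k i * xi) := by
      simp only [Finsupp.sum, Matrix.of_apply, star_sum, star_mul, Finset.sum_mul, Finset.mul_sum]
      simp only [mul_assoc, Finset.sum_comm (s := x.support) (t := Finset.univ)]
      exact Finset.sum_congr rfl fun k _ => Finset.sum_comm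
    rw [h]
    exact Finset.sum_nonneg fun k _ => star_mul_self_nonneg _

end KernelSpaceLemmas

end Subfactor

namespace Subfactor

/-! ### The standard representation of a trace -/

section Standard

variable {A : Type u} [CStarAlgebra A] [PartialOrder A] [StarOrderedRing A] (τ : A →ₚ[ℂ] ℂ)

/-- The map `a ↦ aΩ` as a linear map. -/
def vecLM : A →ₗ[ℂ] L2 τ := (UniformSpace.Completion.toComplL (𝕜 := ℂ)).toLinearMap ∘ₗ
  τ.toPreGNS.toLinearMap

theorem vecLM_apply (a : A) : vecLM τ a = vec τ a := rfl

theorem vec_smul (c : ℂ) (a : A) : vec τ (c • a) = c • vec τ a := (vecLM τ).map_smul c a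

theorem vec_sum {ι : Type*} (s : Finset ι) (f : ι → A) :
    vec τ (∑ i ∈ s, f i) = ∑ i ∈ s, vec τ (f i) := map_sum (vecLM τ) f s

theorem inner_vec (a b : A) : ⟪vec τ a, vec τ b⟫_ℂ = τ (star a * b) := by
  rw [vec, vec, UniformSpace.Completion.inner_coe, PositiveLinearMap.preGNS_inner_def]
  rfl

theorem norm_vec_sq (a : A) : ((‖vec τ a‖ ^ 2 : ℝ) : ℂ) = τ (star a * a) := by
  rw [← inner_vec, inner_self_eq_norm_sq_to_K]
  norm_cast

theorem isTotal_vec : IsTotal (vec τ) := (denseRange_vec τ).isTotal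

theorem norm_leftMul_le (a : A) : ‖leftMul τ a‖ ≤ ‖a‖ :=
  NonUnitalStarAlgHom.norm_apply_le τ.gnsStarAlgHom a

theorem leftMul_sum_apply {ι : Type*} (s : Finset ι) (f : ι → A) (ξ : L2 τ) :
    leftMul τ (∑ i ∈ s, f i) ξ = ∑ i ∈ s, leftMul τ (f i) ξ := by
  rw [leftMul, map_sum, _root_.sum_apply]

theorem leftMul_mul_apply (a b : A) (ξ : L2 τ) :
    leftMul τ (a * b) ξ = leftMul τ a (leftMul τ b ξ) := by
  rw [leftMul, map_mul]; rfl

theorem adjoint_leftMul (a : A) :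
    ContinuousLinearMap.adjoint (leftMul τ a) = leftMul τ (star a) :=
  (map_star τ.gnsStarAlgHom a).symm

theorem inner_leftMul_left (a : A) (ξ ζ : L2 τ) :
    ⟪leftMul τ a ξ, ζ⟫_ℂ = ⟪ξ, leftMul τ (star a) ζ⟫_ℂ := by
  rw [← ContinuousLinearMap.adjoint_inner_right, adjoint_leftMul]

variable {τ}

theorem norm_vec_star (ht : ∀ x y, τ (x * y) = τ (y * x)) (a : A) :
    ‖vec τ (star a)‖ = ‖vec τ a‖ := by
  have h : ((‖vec τ (star a)‖ ^ 2 : ℝ) : ℂ) = ((‖vec τ a‖ ^ 2 : ℝ) : ℂ) := by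
    rw [norm_vec_sq, norm_vec_sq, star_star, ht]
  exact (pow_left_inj₀ (norm_nonneg _) (norm_nonneg _) two_ne_zero).mp (Complex.ofReal_injective h)

/-- Traciality makes `aΩ ↦ a*Ω` norm-preserving, so `aΩ ↦ abΩ` is bounded by the norm of left
multiplication by `b*`. This excludes the default value `0` of `rightMul`. -/
theorem rightMul_vec (ht : ∀ x y, τ (x * y) = τ (y * x)) (b a : A) :
    rightMul τ b (vec τ a) = vec τ (a * b) := by
  refine boundedExt_apply ⟨LinearMap.extendOfNorm (vecLM τ ∘ₗ LinearMap.mulRight ℂ b) (vecLM τ),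
    fun a => LinearMap.extendOfNorm_eq (denseRange_vec τ) ⟨‖leftMul τ (star b)‖, fun x => ?_⟩ a⟩ a
  rw [LinearMap.comp_apply, LinearMap.mulRight_apply, vecLM_apply, vecLM_apply,
    ← norm_vec_star ht, star_mul, ← leftMul_vec, ← norm_vec_star ht x]
  exact ContinuousLinearMap.le_opNorm _ _

theorem adjoint_rightMul (ht : ∀ x y, τ (x * y) = τ (y * x)) (b : A) :
    ContinuousLinearMap.adjoint (rightMul τ b) = rightMul τ (star b) := by
  refine (isTotal_vec τ).adjoint_eq fun x y => ?_
  rw [rightMul_vec ht, rightMul_vec ht, inner_vec, inner_vec, star_mul, ← mul_assoc, ht, mul_assoc]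

theorem inner_rightMul_left (ht : ∀ x y, τ (x * y) = τ (y * x)) (b : A) (ξ ζ : L2 τ) :
    ⟪rightMul τ b ξ, ζ⟫_ℂ = ⟪ξ, rightMul τ (star b) ζ⟫_ℂ := by
  rw [← ContinuousLinearMap.adjoint_inner_right, adjoint_rightMul ht]

theorem rightMul_mul_apply (ht : ∀ x y, τ (x * y) = τ (y * x)) (a b : A) (ξ : L2 τ) :
    rightMul τ (a * b) ξ = rightMul τ b (rightMul τ a ξ) := by
  have h : rightMul τ (a * b) = rightMul τ b ∘L rightMul τ a := (isTotal_vec τ).ext fun c => by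
    simp only [ContinuousLinearMap.comp_apply, rightMul_vec ht, mul_assoc]
  rw [h]; rfl

theorem rightMul_sum_apply (ht : ∀ x y, τ (x * y) = τ (y * x)) {ι : Type*} (s : Finset ι)
    (f : ι → A) (ξ : L2 τ) :
    rightMul τ (∑ i ∈ s, f i) ξ = ∑ i ∈ s, rightMul τ (f i) ξ := by
  have h : rightMul τ (∑ i ∈ s, f i) = ∑ i ∈ s, rightMul τ (f i) := (isTotal_vec τ).ext fun c => by
    simp only [_root_.sum_apply, rightMul_vec ht, Finset.mul_sum, vec_sum]
  rw [h, _root_.sum_apply]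

theorem leftMul_rightMul_comm (a b : A) (ξ : L2 τ) :
    leftMul τ a (rightMul τ b ξ) = rightMul τ b (leftMul τ a ξ) :=
  DFunLike.congr_fun (leftMul_commute_rightMul τ a b).eq ξ

end Standard

/-! ### Inclusions with a finite Pimsner–Popa basis -/

section Inclusion

variable {A : Type u} [CStarAlgebra A] [PartialOrder A] [StarOrderedRing A] {τ : A →ₚ[ℂ] ℂ}

/-- `B ⊂ A` is an inclusion with Pimsner–Popa basis `η`, where `τ` is a faithful tracial state and
the bounded vectors of `L²(A, τ)` are the `aΩ`. -/
structure IsFiniteInclusion (τ : A →ₚ[ℂ] ℂ) (B : StarSubalgebra ℂ A) {n : ℕ} (η : Fin n → A) :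
    Prop where
  normalized : τ 1 = 1
  tracial : ∀ x y, τ (x * y) = τ (y * x)
  faithful : ∀ x, τ (star x * x) = 0 → x = 0
  basis : IsPimsnerPopaBasis τ (B : Set A) η
  bounded : ∀ (ξ : L2 τ) (c : ℝ), (∀ b, ‖rightMul τ b ξ‖ ≤ c * ‖vec τ b‖) → ∃ a, vec τ a = ξ

theorem IsCondExp.apply_star {S : Set A} {E : A →ₗ[ℂ] A} (h : IsCondExp τ S E) (x : A) :
    E (star x) = star (E x) :=
  map_star (PositiveLinearMap.mk₀ E h.pos) x

namespace IsFiniteInclusion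

variable {B : StarSubalgebra ℂ A} {n : ℕ} {η : Fin n → A} (h : IsFiniteInclusion τ B η)

include h

/-- If no conditional expectation existed, `condExp` would be its default `0`, and the basis
identity at `1` would read `0 = 1`, contradicting `τ 1 = 1`. -/
theorem isCondExp : IsCondExp τ (B : Set A) (condExp τ B) := by
  unfold condExp
  split_ifs with hE
  · exact hE.choose_spec
  · have h1 := h.basis 1
    have h0 : (condExp τ (B : Set A)) = 0 := dif_neg hE
    simp only [h0, LinearMap.zero_apply, mul_zero, Finset.sum_const_zero] at h1
    have h2 := h.normalized
    rw [← h1, map_zero] at h2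
    exact absurd h2 zero_ne_one

theorem condExp_star (x : A) : condExp τ B (star x) = star (condExp τ B x) :=
  h.isCondExp.apply_star x

theorem condExp_left {b : A} (hb : b ∈ B) (x : A) : condExp τ B (b * x) = b * condExp τ B x := by
  simpa using h.isCondExp.bimodule b hb 1 B.one_mem x

theorem condExp_right {b : A} (hb : b ∈ B) (x : A) : condExp τ B (x * b) = condExp τ B x * b := by
  simpa using h.isCondExp.bimodule 1 B.one_mem b hb x

theorem sum_right (x : A) : ∑ j, condExp τ B (x * η j) * star (η j) = x := by
  rw [← star_inj, star_sum]
  convert h.basis (star x) using 2 with j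
  rw [star_mul, star_star, ← h.condExp_star, star_mul]

/-- Parseval's identity for the coordinates `E(ηₖ* x)`, obtained by expanding `y` in the basis. It
yields both the positivity of the kernels and the embedding into `L²(M)ⁿ`. -/
theorem condExp_star_mul (x y : A) :
    condExp τ B (star x * y) =
      ∑ k, star (condExp τ B (star (η k) * x)) * condExp τ B (star (η k) * y) := by
  conv_lhs => rw [← h.basis y, Finset.mul_sum, map_sum]
  refine Finset.sum_congr rfl fun k _ => ?_
  rw [← mul_assoc, h.condExp_right (h.isCondExp.mem _), ← h.condExp_star, star_mul, star_star]

theorem trace_mul_condExp {b : A} (hb : b ∈ B) (x : A) : τ (b * condExp τ B x) = τ (b * x) := by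
  rw [← h.condExp_left hb, h.isCondExp.trace]

/-! ### Bounded vectors and the relative tensor product -/

theorem norm_vec_condExp_le (x : A) : ‖vec τ (condExp τ B x)‖ ≤ ‖vec τ x‖ := by
  have h1 : ⟪vec τ (condExp τ B x), vec τ (condExp τ B x)⟫_ℂ =
      ⟪vec τ (condExp τ B x), vec τ x⟫_ℂ := by
    rw [inner_vec, inner_vec, h.trace_mul_condExp (star_mem (h.isCondExp.mem x))]
  have h2 : ‖vec τ (condExp τ B x)‖ * ‖vec τ (condExp τ B x)‖ ≤
      ‖vec τ (condExp τ B x)‖ * ‖vec τ x‖ := by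
    refine le_trans (le_of_eq ?_) (norm_inner_le_norm (𝕜 := ℂ) _ _)
    rw [← h1, inner_self_eq_norm_sq_to_K, sq]
    simp
  rcases (norm_nonneg (vec τ (condExp τ B x))).eq_or_lt with h0 | h0
  · rw [← h0]; exact norm_nonneg _
  · exact le_of_mul_le_mul_left h2 h0

/-- Boundedness over the subalgebra implies boundedness over the whole algebra: `ξ x = ∑ₖ (ξ E(x
ηₖ)) ηₖ*`, where `E` contracts the 2-norm and right multiplications are bounded. -/
theorem exists_vec_of_bounded {ξ : L2 τ} {c : ℝ}
    (hξ : ∀ b ∈ B, ‖rightMul τ b ξ‖ ≤ c * ‖vec τ b‖) : ∃ a, vec τ a = ξ := by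
  have ht := h.tracial
  refine h.bounded ξ (∑ k, ‖rightMul τ (star (η k))‖ * (|c| * ‖rightMul τ (η k)‖)) fun x => ?_
  conv_lhs => rw [← h.sum_right x, rightMul_sum_apply ht]
  rw [Finset.sum_mul]
  refine (norm_sum_le _ _).trans (Finset.sum_le_sum fun k _ => ?_)
  rw [rightMul_mul_apply ht, mul_assoc, mul_assoc]
  refine (ContinuousLinearMap.le_opNorm _ _).trans (mul_le_mul_of_nonneg_left ?_ (norm_nonneg _))
  calc _ ≤ c * ‖vec τ (condExp τ B (x * η k))‖ := hξ _ (h.isCondExp.mem _)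
    _ ≤ |c| * ‖vec τ (condExp τ B (x * η k))‖ :=
      mul_le_mul_of_nonneg_right (le_abs_self c) (norm_nonneg _)
    _ ≤ |c| * ‖vec τ (x * η k)‖ :=
      mul_le_mul_of_nonneg_left (h.norm_vec_condExp_le _) (abs_nonneg c)
    _ ≤ _ := by
      rw [← rightMul_vec ht]
      exact mul_le_mul_of_nonneg_left (ContinuousLinearMap.le_opNorm _ _) (abs_nonneg c)

theorem exists_vec_eq (ξ : boundedVectors τ (B : Set A)) : ∃ a, vec τ a = ξ :=
  h.exists_vec_of_bounded ξ.2.choose_spec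

/-- The element `E(x* y)` satisfies the defining relation of `subInner`. The difference of two
solutions lies in `B` and is orthogonal to `BΩ`, hence to itself, so faithfulness makes the chosen
solution equal to it. -/
theorem subInner_vec (x y : A) : subInner τ B (vec τ x) (vec τ y) = condExp τ B (star x * y) := by
  have ht := h.tracial
  have key : ∀ b ∈ B, ∀ c ∈ B, ⟪rightMul τ b (vec τ x), rightMul τ c (vec τ y)⟫_ℂ =
      ⟪vec τ b, vec τ (condExp τ B (star x * y) * c)⟫_ℂ := fun b hb c hc => by
    rw [rightMul_vec ht, rightMul_vec ht, inner_vec, inner_vec, ← h.condExp_right hc,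
      h.trace_mul_condExp (star_mem hb), star_mul]
    simp only [mul_assoc]
  have hex : ∃ m ∈ (B : Set A), ∀ b ∈ (B : Set A), ∀ c ∈ (B : Set A),
      ⟪rightMul τ b (vec τ x), rightMul τ c (vec τ y)⟫_ℂ = ⟪vec τ b, vec τ (m * c)⟫_ℂ :=
    ⟨_, h.isCondExp.mem _, key⟩
  unfold subInner
  rw [dif_pos hex]
  obtain ⟨hm, hm'⟩ := hex.choose_spec
  refine sub_eq_zero.mp (h.faithful _ ?_)
  have h1 : ∀ b ∈ B, τ (star b * (hex.choose - condExp τ B (star x * y))) = 0 := fun b hb => by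
    have h2 := (hm' b hb 1 B.one_mem).symm.trans (key b hb 1 B.one_mem)
    rw [inner_vec, inner_vec, mul_one, mul_one] at h2
    rw [mul_sub, map_sub, h2, sub_self]
  exact h1 _ (sub_mem hm (h.isCondExp.mem _))

theorem leftMul_condExp_star_mul (x y : A) :
    leftMul τ (condExp τ B (star x * y)) =
      ∑ k, star (leftMul τ (condExp τ B (star (η k) * x))) *
        leftMul τ (condExp τ B (star (η k) * y)) := by
  rw [h.condExp_star_mul]
  simp only [leftMul, map_sum, map_mul, map_star]

/-- Needed so that `psdKernel` keeps the given kernel instead of replacing it by `0`; the same holds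
for `posSemidef_tensorKernel`. -/
theorem posSemidef_corrKernel : (corrKernel τ (condExp τ B)).PosSemidef := by
  have hk : corrKernel τ (condExp τ B) = Matrix.of fun x y =>
      ∑ k, star (leftMul τ (condExp τ B (star (η k) * x))) *
        leftMul τ (condExp τ B (star (η k) * y)) := by
    funext x y
    exact h.leftMul_condExp_star_mul x y
  rw [hk]
  exact posSemidef_sum_star_mul fun k x => leftMul τ (condExp τ B (star (η k) * x))

theorem posSemidef_tensorKernel : (tensorKernel τ (B : Set A)).PosSemidef := by
  choose c hc using h.exists_vec_eq
  have hk : tensorKernel τ (B : Set A) = Matrix.of fun ξ ζ =>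
      ∑ k, star (leftMul τ (condExp τ B (star (η k) * c ξ))) *
        leftMul τ (condExp τ B (star (η k) * c ζ)) := by
    ext ξ ζ : 2
    rw [tensorKernel, Matrix.of_apply, Matrix.of_apply, ← hc, ← hc, h.subInner_vec,
      h.leftMul_condExp_star_mul]
  rw [hk]
  exact posSemidef_sum_star_mul fun k x => leftMul τ (condExp τ B (star (η k) * c x))

theorem inner_corr (x y : A) (ξ ζ : L2 τ) :
    ⟪symb (corrKernel τ (condExp τ B)) x ξ, symb (corrKernel τ (condExp τ B)) y ζ⟫_ℂ =
      ⟪ξ, leftMul τ (condExp τ B (star x * y)) ζ⟫_ℂ :=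
  inner_symb h.posSemidef_corrKernel x y ξ ζ

theorem inner_tmul (x y : A) (ξ ζ : L2 τ) :
    ⟪tmul τ (B : Set A) ⟨vec τ x, vec_mem_boundedVectors τ B x⟩ ξ,
      tmul τ (B : Set A) ⟨vec τ y, vec_mem_boundedVectors τ B y⟩ ζ⟫_ℂ =
      ⟪ξ, leftMul τ (condExp τ B (star x * y)) ζ⟫_ℂ := by
  rw [tmul, tmul, inner_symb h.posSemidef_tensorKernel, tensorKernel, Matrix.of_apply,
    h.subInner_vec]

theorem isTotal_tmul : IsTotal fun p : A × L2 τ =>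
    tmul τ (B : Set A) ⟨vec τ p.1, vec_mem_boundedVectors τ B p.1⟩ p.2 := by
  refine (isTotal_symb (tensorKernel τ (B : Set A))).mono (Submodule.span_mono ?_)
  rintro _ ⟨⟨⟨ξ, hξ⟩, ζ⟩, rfl⟩
  obtain ⟨a, ha⟩ := h.exists_vec_eq ⟨ξ, hξ⟩
  change vec τ a = ξ at ha
  subst ha
  exact ⟨(a, ζ), rfl⟩

theorem exists_unitary : ∃ U : Corr τ (condExp τ B) ≃ₗᵢ[ℂ] RelTensor τ (B : Set A),
    ∀ x ξ, U (symb (corrKernel τ (condExp τ B)) x ξ) =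
      tmul τ (B : Set A) ⟨vec τ x, vec_mem_boundedVectors τ B x⟩ ξ := by
  obtain ⟨U, hU⟩ := (isTotal_symb (corrKernel τ (condExp τ B))).exists_linearIsometryEquiv
    h.isTotal_tmul fun p q => by rw [h.inner_corr, h.inner_tmul]
  exact ⟨U, fun x ξ => hU (x, ξ)⟩

end IsFiniteInclusion

end Inclusion

end Subfactor

namespace Subfactor

/-! ### Factorization of completely positive maps -/

section CompletelyPositive

variable {A B : Type*} [CStarAlgebra A] [PartialOrder A] [StarOrderedRing A]
  [CStarAlgebra B] [PartialOrder B] [StarOrderedRing B]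

/-- The matrix is `R* R`, where `R` has the entries `a j` in one row and zeros elsewhere. -/
theorem cstarMatrix_star_mul_nonneg {ι : Type*} [Fintype ι] (a : ι → A) :
    0 ≤ CStarMatrix.ofMatrix (fun i j => star (a i) * a j : Matrix ι ι A) := by
  classical
  rcases isEmpty_or_nonempty ι with hι | ⟨⟨i₀⟩⟩
  · exact le_of_eq (CStarMatrix.ext fun i => hι.elim i)
  · have key : CStarMatrix.ofMatrix (fun i j => star (a i) * a j : Matrix ι ι A) =
        star (CStarMatrix.ofMatrix (fun p j => if p = i₀ then a j else 0 : Matrix ι ι A)) *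
          CStarMatrix.ofMatrix (fun p j => if p = i₀ then a j else 0 : Matrix ι ι A) := by
      ext i j
      rw [CStarMatrix.mul_apply]
      simp only [CStarMatrix.star_apply]
      change star (a i) * a j =
        ∑ x, star (if x = i₀ then a i else 0) * (if x = i₀ then a j else 0)
      simp
    rw [key]
    exact star_mul_self_nonneg _

theorem exists_eq_star_mul_self {a : A} (ha : 0 ≤ a) : ∃ b, a = star b * b :=
  CStarAlgebra.nonneg_iff_eq_star_mul_self.mp ha

theorem exists_eq_sum_star_mul {ι : Type*} [Fintype ι] {X : CStarMatrix ι ι A} (hX : 0 ≤ X) :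
    ∃ D : ι → ι → A, ∀ i j, X i j = ∑ m, star (D m i) * D m j := by
  classical
  obtain ⟨D, hD⟩ := exists_eq_star_mul_self hX
  refine ⟨fun m i => D m i, fun i j => ?_⟩
  rw [hD, CStarMatrix.mul_apply]
  simp [CStarMatrix.star_apply]

theorem sum_star_mul_sum {ι κ R : Type*} [Fintype ι] [Fintype κ] [Ring R] [StarRing R]
    (C : κ → ι → R) (u v : ι → R) :
    ∑ m, star (∑ l, C m l * u l) * ∑ l, C m l * v l =
      ∑ k, ∑ l, star (u k) * (∑ m, star (C m k) * C m l) * v l := by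
  simp only [star_sum, star_mul, Finset.mul_sum, Finset.sum_mul]
  conv_lhs => enter [2, m]; rw [Finset.sum_comm]
  rw [Finset.sum_comm]
  refine Finset.sum_congr rfl fun k _ => ?_
  rw [Finset.sum_comm]
  simp only [mul_assoc]

theorem _root_.CompletelyPositiveMap.exists_factor {ι : Type*} [Fintype ι] (Φ : A →CP B)
    (a : ι → A) : ∃ D : ι → ι → B, ∀ k l, Φ (star (a k) * a l) = ∑ m, star (D m k) * D m l :=
  exists_eq_sum_star_mul (Φ.map_cstarMatrix_nonneg _ (cstarMatrix_star_mul_nonneg a))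

end CompletelyPositive

/-! ### Operator matrices on finite powers of a Hilbert space -/

section Model

variable {H : Type*} [NormedAddCommGroup H] [InnerProductSpace ℂ H]

/-- The operator on `Hⁿ` with the operator matrix `T`. -/
def matrixOp {n : ℕ} (T : Fin n → Fin n → H →L[ℂ] H) :
    PiLp 2 (fun _ : Fin n => H) →L[ℂ] PiLp 2 (fun _ : Fin n => H) :=
  (PiLp.continuousLinearEquiv 2 ℂ (fun _ : Fin n => H)).symm.toContinuousLinearMap ∘L
    ContinuousLinearMap.pi fun k => ∑ l, T k l ∘L PiLp.proj 2 (fun _ : Fin n => H) l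

theorem matrixOp_apply {n : ℕ} (T : Fin n → Fin n → H →L[ℂ] H) (v : PiLp 2 (fun _ : Fin n => H))
    (k : Fin n) : matrixOp T v k = ∑ l, T k l (v l) := by
  simp [matrixOp]

end Model

namespace IsFiniteInclusion

variable {A : Type u} [CStarAlgebra A] [PartialOrder A] [StarOrderedRing A] {τ : A →ₚ[ℂ] ℂ}
variable {B : StarSubalgebra ℂ A} {n : ℕ} {η : Fin n → A} (h : IsFiniteInclusion τ B η)

include h

/-! ### The correspondence of the conditional expectation -/

theorem exists_model : ∃ V : Corr τ (condExp τ B) →ₗᵢ[ℂ] PiLp 2 (fun _ : Fin n => L2 τ),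
    ∀ x ξ k, V (symb (corrKernel τ (condExp τ B)) x ξ) k =
      leftMul τ (condExp τ B (star (η k) * x)) ξ := by
  obtain ⟨V, hV⟩ := (isTotal_symb (corrKernel τ (condExp τ B))).exists_linearIsometry
    (g := fun p => WithLp.toLp 2 fun k => leftMul τ (condExp τ B (star (η k) * p.1)) p.2)
    fun p q => by
      rw [h.inner_corr, PiLp.inner_apply, h.condExp_star_mul, leftMul_sum_apply, inner_sum]
      refine Finset.sum_congr rfl fun k _ => ?_
      rw [leftMul_mul_apply, inner_leftMul_left]
  exact ⟨V, fun x ξ k => by rw [hV (x, ξ)]⟩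

theorem corrLeft_symb (a x : A) (ξ : L2 τ) :
    corrLeft τ (condExp τ B) a (symb (corrKernel τ (condExp τ B)) x ξ) =
      symb (corrKernel τ (condExp τ B)) (a * x) ξ := by
  obtain ⟨V, hV⟩ := h.exists_model
  -- In the coordinates `E(ηₖ* x)`, left multiplication by `a` is the matrix `E(ηₖ* a ηₗ)`.
  refine boundedExt_apply (exists_of_linearIsometry V
    (matrixOp fun k l => leftMul τ (condExp τ B (star (η k) * a * η l))) fun p => ?_) (x, ξ)
  ext k
  simp only [matrixOp_apply, hV, ← leftMul_mul_apply]
  rw [← leftMul_sum_apply]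
  congr 2
  conv_rhs => rw [← h.basis p.1]
  simp only [Finset.mul_sum, map_sum, ← mul_assoc, h.condExp_right (h.isCondExp.mem _)]

theorem corrRight_symb (b x : A) (ξ : L2 τ) :
    corrRight τ (condExp τ B) b (symb (corrKernel τ (condExp τ B)) x ξ) =
      symb (corrKernel τ (condExp τ B)) x (rightMul τ b ξ) := by
  obtain ⟨V, hV⟩ := h.exists_model
  -- The right action is diagonal in the model, since it commutes with the coordinates, which act
  -- from the left.
  refine boundedExt_apply (exists_of_linearIsometry V
    (matrixOp fun k l => if k = l then rightMul τ b else 0) fun p => ?_) (x, ξ)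
  ext k
  rw [matrixOp_apply, Finset.sum_eq_single k (fun l _ hl => by rw [if_neg (Ne.symm hl)]; rfl)
    (fun hk => absurd (Finset.mem_univ k) hk), if_pos rfl, hV, hV, leftMul_rightMul_comm]

theorem adjoint_corrLeft (a : A) : ContinuousLinearMap.adjoint (corrLeft τ (condExp τ B) a) =
    corrLeft τ (condExp τ B) (star a) :=
  (isTotal_symb _).adjoint_eq fun p q => by
    rw [h.corrLeft_symb, h.corrLeft_symb, h.inner_corr, h.inner_corr, star_mul, mul_assoc]

theorem adjoint_corrV_symb (x : A) (ξ : L2 τ) :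
    ContinuousLinearMap.adjoint (corrV τ (condExp τ B)) (symb (corrKernel τ (condExp τ B)) x ξ) =
      leftMul τ (condExp τ B x) ξ :=
  ext_inner_left ℂ fun ζ => by
    rw [ContinuousLinearMap.adjoint_inner_right, corrV, h.inner_corr, star_one, one_mul]

/-! ### The derivative -/

variable {Φ : A →CP A} (hΦ : ∀ a ∈ B, ∀ b ∈ B, ∀ x, Φ (a * x * b) = a * Φ x * b)

include hΦ

/-- Expanding both arguments in the basis and pulling the coefficients in `B` out of `Φ` shows that
`Φ` is determined by the finite matrix `Φ(ηₖ* ηₗ)`. -/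
theorem map_star_mul_eq (x y : A) :
    Φ (star x * y) = ∑ k, ∑ l, star (condExp τ B (star (η k) * x)) * Φ (star (η k) * η l) *
      condExp τ B (star (η l) * y) := by
  conv_lhs => rw [← h.basis x, ← h.basis y, star_sum, Finset.sum_mul_sum]
  simp only [map_sum]
  refine Finset.sum_congr rfl fun k _ => Finset.sum_congr rfl fun l _ => ?_
  rw [star_mul, ← hΦ _ (star_mem (h.isCondExp.mem _)) _ (h.isCondExp.mem _)]
  simp only [mul_assoc]

theorem sum_condExp_mul_map (x : A) :
    ∑ j, condExp τ B (x * η j) * Φ (star (η j)) = Φ x := by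
  conv_rhs => rw [← h.sum_right x, map_sum]
  refine Finset.sum_congr rfl fun j _ => ?_
  simpa using (hΦ _ (h.isCondExp.mem (x * η j)) 1 B.one_mem (star (η j))).symm

/-- Subtracting the expansion of `Φ(x* y)` from `c` times Parseval's identity leaves the quadratic
form of `c - Q`. Factoring `c - Q = C* C` writes `cE - Φ` as a sum of squares. -/
theorem majorized : Majorized Φ.toLinearMap (condExp τ B) := by
  classical
  let Q : CStarMatrix (Fin n) (Fin n) A :=
    (CStarMatrix.ofMatrix (fun i j => star (η i) * η j : Matrix (Fin n) (Fin n) A)).map Φ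
  have hQ : 0 ≤ Q := Φ.map_cstarMatrix_nonneg _ (cstarMatrix_star_mul_nonneg η)
  -- The constant is `‖Q‖ + 1` rather than `‖Q‖` so that it is strictly positive even when `Q = 0`.
  have hQ1 : 0 ≤ algebraMap ℝ (CStarMatrix (Fin n) (Fin n) A) (‖Q‖ + 1) - Q := by
    rw [map_add]
    refine sub_nonneg.mpr ((IsSelfAdjoint.le_algebraMap_norm_self
      (IsSelfAdjoint.of_nonneg hQ)).trans (le_add_of_nonneg_right ?_))
    rw [map_one]
    exact zero_le_one
  obtain ⟨C, hC⟩ := exists_eq_sum_star_mul hQ1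
  have key : ∀ x y, ((‖Q‖ + 1 : ℝ) : ℂ) • condExp τ B (star x * y) - Φ (star x * y) =
      ∑ m, star (∑ l, C m l * condExp τ B (star (η l) * x)) *
        ∑ l, C m l * condExp τ B (star (η l) * y) := fun x y => by
    have hC' : ∀ i j, ∑ m, star (C m i) * C m j =
        (if i = j then ((‖Q‖ + 1 : ℝ) : ℂ) • 1 else 0) - Φ (star (η i) * η j) := fun i j => by
      rw [← hC, CStarMatrix.sub_apply, CStarMatrix.algebraMap_apply]
      congr 1
      rw [Algebra.algebraMap_eq_smul_one, Complex.coe_smul]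
    rw [sum_star_mul_sum, h.condExp_star_mul, h.map_star_mul_eq hΦ, Finset.smul_sum,
      ← Finset.sum_sub_distrib]
    refine Finset.sum_congr rfl fun k _ => ?_
    simp only [hC', mul_sub, sub_mul, Finset.sum_sub_distrib]
    congr 1
    rw [Finset.sum_eq_single k (fun l _ hl => by rw [if_neg (Ne.symm hl), mul_zero, zero_mul])
      (fun hk => absurd (Finset.mem_univ k) hk), if_pos rfl, mul_smul_comm, mul_one,
      smul_mul_assoc]
  refine ⟨‖Q‖ + 1, by positivity, ⟨((‖Q‖ + 1 : ℝ) : ℂ) • condExp τ B - Φ.toLinearMap, ?_⟩, rfl⟩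
  intro k X hX
  obtain ⟨D, hD⟩ := exists_eq_sum_star_mul hX
  -- With `X = D* D`, each entry of the amplified map is a sum over `p` and `m` of products to which
  -- `key` applies, so the image is a sum of positive matrices of rank-one form.
  have h1 : X.map (((‖Q‖ + 1 : ℝ) : ℂ) • condExp τ B - Φ.toLinearMap) =
      ∑ p, ∑ m, CStarMatrix.ofMatrix fun i j =>
        star (∑ l, C m l * condExp τ B (star (η l) * D p i)) *
          ∑ l, C m l * condExp τ B (star (η l) * D p j) := by
    ext i j
    have hs : ∀ {ι : Type} (s : Finset ι) (f : ι → CStarMatrix (Fin k) (Fin k) A),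
        (∑ p ∈ s, f p) i j = ∑ p ∈ s, f p i j := fun s f => Matrix.sum_apply i j s f
    simp only [hs]
    refine Eq.trans ?_ (Finset.sum_congr rfl fun p _ => key (D p i) (D p j))
    rw [CStarMatrix.map_apply, hD, map_sum]
    rfl
  rw [h1]
  exact Finset.sum_nonneg fun p _ => Finset.sum_nonneg fun m _ => cstarMatrix_star_mul_nonneg _

/-- The operator is `G* G`, with `G` the embedding into `L²(M)ⁿ` followed by a factor `D` of `Φ(ηₖ*
ηₗ) = ∑ₘ D(m,k)* D(m,l)`. Positivity is then automatic, and the explicit formula follows by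
comparing matrix coefficients. -/
theorem exists_derivative : ∃ F : Corr τ (condExp τ B) →L[ℂ] Corr τ (condExp τ B), 0 ≤ F ∧
    (∀ x ξ, F (symb (corrKernel τ (condExp τ B)) x ξ) =
      ∑ j, symb (corrKernel τ (condExp τ B)) (x * η j) (leftMul τ (Φ (star (η j))) ξ)) ∧
    ∀ x y ξ ζ, ⟪symb (corrKernel τ (condExp τ B)) x ξ,
      F (symb (corrKernel τ (condExp τ B)) y ζ)⟫_ℂ = ⟪ξ, leftMul τ (Φ (star x * y)) ζ⟫_ℂ := by
  obtain ⟨V, hV⟩ := h.exists_model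
  obtain ⟨D, hD⟩ := Φ.exists_factor η
  let G := matrixOp (fun m l => leftMul τ (D m l)) ∘L V.toContinuousLinearMap
  have hG : ∀ x ξ m, G (symb (corrKernel τ (condExp τ B)) x ξ) m =
      leftMul τ (∑ l, D m l * condExp τ B (star (η l) * x)) ξ := fun x ξ m => by
    simp only [G, ContinuousLinearMap.comp_apply, matrixOp_apply,
      LinearIsometry.coe_toContinuousLinearMap, hV, leftMul_sum_apply, leftMul_mul_apply]
  have hF : ∀ x y ξ ζ, ⟪symb (corrKernel τ (condExp τ B)) x ξ,
      (ContinuousLinearMap.adjoint G ∘L G) (symb (corrKernel τ (condExp τ B)) y ζ)⟫_ℂ =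
      ⟪ξ, leftMul τ (Φ (star x * y)) ζ⟫_ℂ := fun x y ξ ζ => by
    rw [ContinuousLinearMap.comp_apply, ContinuousLinearMap.adjoint_inner_right, PiLp.inner_apply]
    simp only [hG, inner_leftMul_left, ← leftMul_mul_apply]
    rw [← inner_sum, ← leftMul_sum_apply, h.map_star_mul_eq hΦ]
    simp only [hD]
    rw [← sum_star_mul_sum]
  refine ⟨ContinuousLinearMap.adjoint G ∘L G, ?_, fun x ξ => ?_, hF⟩
  · exact (ContinuousLinearMap.nonneg_iff_isPositive _).mpr
      (ContinuousLinearMap.isPositive_adjoint_comp_self G)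
  · refine (isTotal_symb _).ext_inner fun p => ?_
    rw [hF, inner_sum]
    simp only [h.inner_corr, ← leftMul_mul_apply, ← mul_assoc]
    rw [← inner_sum, ← leftMul_sum_apply, h.sum_condExp_mul_map hΦ]

omit hΦ in
-- Every symbol is `π(x) v ξ`. Since a derivative commutes with `π`, both factors `π(x)` and `π(y)`
-- merge into `π(x* y)` and the defining formula applies. All matrix coefficients are thus
-- prescribed by `Φ`, which gives uniqueness.
theorem isDerivative_inner {Φ : A →ₗ[ℂ] A} {F : Corr τ (condExp τ B) →L[ℂ] Corr τ (condExp τ B)}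
    (hF : IsDerivative τ Φ (condExp τ B) F) (x y : A) (ξ ζ : L2 τ) :
    ⟪symb (corrKernel τ (condExp τ B)) x ξ, F (symb (corrKernel τ (condExp τ B)) y ζ)⟫_ℂ =
      ⟪ξ, leftMul τ (Φ (star x * y)) ζ⟫_ℂ := by
  have hs : ∀ z ξ, symb (corrKernel τ (condExp τ B)) z ξ =
      corrLeft τ (condExp τ B) z (corrV τ (condExp τ B) ξ) := fun z ξ => by
    rw [corrV, h.corrLeft_symb, mul_one]
  have hc : ∀ z u, F (corrLeft τ (condExp τ B) z u) = corrLeft τ (condExp τ B) z (F u) :=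
    fun z u => (DFunLike.congr_fun (hF.mem.1 z).eq u).symm
  have hm : corrLeft τ (condExp τ B) (star x) ∘L corrLeft τ (condExp τ B) y =
      corrLeft τ (condExp τ B) (star x * y) := (isTotal_symb _).ext fun p => by
    simp only [ContinuousLinearMap.comp_apply, h.corrLeft_symb, mul_assoc]
  rw [hs, hs, hc, ← ContinuousLinearMap.adjoint_inner_right, h.adjoint_corrLeft,
    ← ContinuousLinearMap.comp_apply, hm, ← ContinuousLinearMap.adjoint_inner_right,
    hF.implements]
  rfl

theorem isDerivative {F : Corr τ (condExp τ B) →L[ℂ] Corr τ (condExp τ B)} (h0 : 0 ≤ F)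
    (hF : ∀ x ξ, F (symb (corrKernel τ (condExp τ B)) x ξ) =
      ∑ j, symb (corrKernel τ (condExp τ B)) (x * η j) (leftMul τ (Φ (star (η j))) ξ)) :
    IsDerivative τ Φ.toLinearMap (condExp τ B) F where
  mem := by
    refine ⟨fun a => (isTotal_symb _).commute fun p => ?_,
      fun b => (isTotal_symb _).commute fun p => ?_⟩
    · simp only [hF, map_sum, h.corrLeft_symb, mul_assoc]
    · simp only [hF, map_sum, h.corrRight_symb, leftMul_rightMul_comm]
  nonneg := h0
  implements a := by
    ext ξ
    simp only [ContinuousLinearMap.comp_apply]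
    rw [corrV, hF]
    simp only [map_sum, h.corrLeft_symb, one_mul]
    change _ = ∑ j, ContinuousLinearMap.adjoint (corrV τ (condExp τ B)) _
    simp only [h.adjoint_corrV_symb, ← leftMul_mul_apply]
    rw [← leftMul_sum_apply, h.sum_condExp_mul_map hΦ]
    rfl

theorem exists_unique_isDerivative : ∃! F, IsDerivative τ Φ.toLinearMap (condExp τ B) F := by
  obtain ⟨F, h0, hF, hF'⟩ := h.exists_derivative hΦ
  refine ⟨F, h.isDerivative hΦ h0 hF, fun F' hF₁ => (isTotal_symb _).ext fun p =>
    (isTotal_symb _).ext_inner fun q => ?_⟩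
  rw [h.isDerivative_inner hF₁, hF']
  rfl

theorem derivative_symb (x : A) (ξ : L2 τ) :
    derivative τ Φ.toLinearMap (condExp τ B) (symb (corrKernel τ (condExp τ B)) x ξ) =
      ∑ j, symb (corrKernel τ (condExp τ B)) (x * η j) (leftMul τ (Φ (star (η j))) ξ) := by
  have hu := h.exists_unique_isDerivative hΦ
  obtain ⟨F, h0, hF, -⟩ := h.exists_derivative hΦ
  have hd : derivative τ Φ.toLinearMap (condExp τ B) = F := by
    unfold derivative
    rw [dif_pos hu]
    exact hu.unique hu.choose_spec.1 (h.isDerivative hΦ h0 hF)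
  rw [hd, hF]

theorem derivative_mem_corrEnd :
    derivative τ Φ.toLinearMap (condExp τ B) ∈ corrEnd τ (condExp τ B) := by
  obtain ⟨F, h0, hF, -⟩ := h.exists_derivative hΦ
  have hd : derivative τ Φ.toLinearMap (condExp τ B) = F :=
    (isTotal_symb _).ext fun p => by rw [h.derivative_symb hΦ, hF]
  rw [hd]
  exact (h.isDerivative hΦ h0 hF).mem

end IsFiniteInclusion

end Subfactor

namespace Subfactor

/-! ### Commutants under unitary conjugation -/

section Intertwiner

variable {H H' I J : Type*} [NormedAddCommGroup H] [InnerProductSpace ℂ H]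
  [CompleteSpace H] [NormedAddCommGroup H'] [InnerProductSpace ℂ H'] [CompleteSpace H']

theorem commute_conj_iff {U : H ≃ₗᵢ[ℂ] H'} {L : H →L[ℂ] H} {L' : H' →L[ℂ] H'}
    (hL : ∀ x, U (L x) = L' (U x)) (T : H →L[ℂ] H) :
    Commute L' (U.conjStarAlgEquiv T) ↔ Commute L T := by
  have h : L' = U.conjStarAlgEquiv L := by
    ext y
    rw [LinearIsometryEquiv.conjStarAlgEquiv_apply_apply, hL, LinearIsometryEquiv.apply_symm_apply]
  rw [h]
  exact ⟨fun hc => U.conjStarAlgEquiv.injective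
      ((map_mul _ L T).trans (hc.eq.trans (map_mul _ T L).symm)),
    fun hc => (map_mul _ L T).symm.trans ((congrArg _ hc.eq).trans (map_mul _ T L))⟩

/-- Conjugation by a unitary bimodule map identifies the bimodule endomorphisms. -/
theorem conj_image_bimoduleEnd {U : H ≃ₗᵢ[ℂ] H'} {L : I → H →L[ℂ] H} {R : J → H →L[ℂ] H}
    {L' : I → H' →L[ℂ] H'} {R' : J → H' →L[ℂ] H'}
    (hL : ∀ a x, U (L a x) = L' a (U x)) (hR : ∀ a x, U (R a x) = R' a (U x)) :
    U.conjStarAlgEquiv '' bimoduleEnd L R = bimoduleEnd L' R' := by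
  have key : ∀ T, U.conjStarAlgEquiv T ∈ bimoduleEnd L' R' ↔ T ∈ bimoduleEnd L R := fun T =>
    and_congr (forall_congr' fun a => commute_conj_iff (hL a) T)
      (forall_congr' fun b => commute_conj_iff (hR b) T)
  ext T
  constructor
  · rintro ⟨T, hT, rfl⟩
    exact (key T).mpr hT
  · intro hT
    refine ⟨U.conjStarAlgEquiv.symm T, (key _).mp ?_, U.conjStarAlgEquiv.apply_symm_apply T⟩
    rwa [U.conjStarAlgEquiv.apply_symm_apply T]

variable {H'' : Type*} [NormedAddCommGroup H''] [InnerProductSpace ℂ H''] [CompleteSpace H'']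
  {U : H ≃ₗᵢ[ℂ] H'}

theorem conj_trans_mem {W : H' ≃ₗᵢ[ℂ] H''} {S : Set (H →L[ℂ] H)} {S' : Set (H' →L[ℂ] H')}
    {S'' : Set (H'' →L[ℂ] H'')} (hU : U.conjStarAlgEquiv '' S = S')
    (hW : W.conjStarAlgEquiv '' S' = S'') {T : H →L[ℂ] H} (hT : T ∈ S) :
    (U.trans W).conjStarAlgEquiv T ∈ S'' :=
  hW ▸ hU ▸ ⟨_, ⟨T, hT, rfl⟩, rfl⟩

theorem conj_trans_eq_smul (W : H' ≃ₗᵢ[ℂ] H'') {T : H →L[ℂ] H} {F : H' →L[ℂ] H'} {c : ℂ}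
    (hT : U.conjStarAlgEquiv T = c • F) :
    (U.trans W).conjStarAlgEquiv T = c • W.conjStarAlgEquiv F := by
  rw [← map_smul, ← hT]
  rfl

end Intertwiner

/-! ### Transport of multiplication operators along a unitary -/

section Transport

variable {C : Type u} [CStarAlgebra C] [PartialOrder C] [StarOrderedRing C] {σ : C →ₚ[ℂ] ℂ}
  {H I : Type*} [NormedAddCommGroup H] [InnerProductSpace ℂ H]
  {κ : L2 σ ≃ₗᵢ[ℂ] H}

theorem map_leftMul_of_forall {c : C} {J : I → C} {L : H →L[ℂ] H}
    (hJ : ∀ z, z ∈ Submodule.span ℂ (Set.range J))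
    (hL : ∀ p, κ (vec σ (c * J p)) = L (κ (vec σ (J p)))) (ξ : L2 σ) :
    κ (leftMul σ c ξ) = L (κ ξ) := by
  have h1 : κ.toLinearEquiv.toLinearMap ∘ₗ vecLM σ ∘ₗ LinearMap.mulLeft ℂ c =
      L.toLinearMap ∘ₗ κ.toLinearEquiv.toLinearMap ∘ₗ vecLM σ :=
    LinearMap.ext_on_range (v := J) (Submodule.eq_top_iff'.mpr hJ) hL
  have h2 : κ.toContinuousLinearEquiv.toContinuousLinearMap ∘L leftMul σ c =
      L ∘L κ.toContinuousLinearEquiv.toContinuousLinearMap := (isTotal_vec σ).ext fun z => by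
    change κ (leftMul σ c (vec σ z)) = L (κ (vec σ z))
    rw [leftMul_vec]
    exact LinearMap.congr_fun h1 z
  exact DFunLike.congr_fun h2 ξ

variable [CompleteSpace H]

/-- No traciality of `σ` is assumed: the bounded operator required by `rightMul` is obtained by
pulling `R` back through `κ`. The family `J` spans `C` algebraically, so the relation extends
linearly to all of `C`. -/
theorem map_rightMul_of_forall {c : C} {J : I → C} {R : H →L[ℂ] H}
    (hJ : ∀ z, z ∈ Submodule.span ℂ (Set.range J))
    (hR : ∀ p, κ (vec σ (J p * c)) = R (κ (vec σ (J p)))) (ξ : L2 σ) :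
    κ (rightMul σ c ξ) = R (κ ξ) := by
  have h1 : κ.toLinearEquiv.toLinearMap ∘ₗ vecLM σ ∘ₗ LinearMap.mulRight ℂ c =
      R.toLinearMap ∘ₗ κ.toLinearEquiv.toLinearMap ∘ₗ vecLM σ :=
    LinearMap.ext_on_range (v := J) (Submodule.eq_top_iff'.mpr hJ) hR
  have hT : ∀ z, κ.symm.conjStarAlgEquiv R (vec σ z) = vec σ (z * c) := fun z => by
    apply κ.injective
    rw [LinearIsometryEquiv.conjStarAlgEquiv_apply_apply, κ.apply_symm_apply]
    exact (LinearMap.congr_fun h1 z).symm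
  have h2 : rightMul σ c = κ.symm.conjStarAlgEquiv R := (isTotal_vec σ).ext fun z => by
    rw [hT]
    exact boundedExt_apply ⟨_, hT⟩ z
  rw [h2, LinearIsometryEquiv.conjStarAlgEquiv_apply_apply, κ.apply_symm_apply]
  rfl

theorem star_eq_of_intertwine {T T' : L2 σ →L[ℂ] L2 σ} {R : H →L[ℂ] H}
    (hT : ∀ ξ, κ (T ξ) = R (κ ξ))
    (hT' : ∀ ξ, κ (T' ξ) = ContinuousLinearMap.adjoint R (κ ξ)) : star T = T' := by
  ext ξ
  refine ext_inner_left ℂ fun ζ => ?_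
  rw [ContinuousLinearMap.star_eq_adjoint, ContinuousLinearMap.adjoint_inner_right,
    ← κ.inner_map_map, hT, ← ContinuousLinearMap.adjoint_inner_right, ← hT', κ.inner_map_map]

end Transport

namespace IsFiniteInclusion

variable {A : Type u} [CStarAlgebra A] [PartialOrder A] [StarOrderedRing A] {τ : A →ₚ[ℂ] ℂ}
variable {B : StarSubalgebra ℂ A} {n : ℕ} {η : Fin n → A} (h : IsFiniteInclusion τ B η)

include h

/-! ### The actions on the relative tensor product -/

theorem tensorLeft_tmul (a x : A) (ξ : L2 τ) :
    tensorLeft τ (B : Set A) a (tmul τ B ⟨vec τ x, vec_mem_boundedVectors τ B x⟩ ξ) =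
      tmul τ (B : Set A) ⟨vec τ (a * x), vec_mem_boundedVectors τ B (a * x)⟩ ξ := by
  obtain ⟨U, hU⟩ := h.exists_unitary
  have hl : ∀ x, (⟨leftMul τ a (vec τ x), leftMul_mem_boundedVectors τ B a
      (vec_mem_boundedVectors τ B x)⟩ : boundedVectors τ (B : Set A)) =
      ⟨vec τ (a * x), vec_mem_boundedVectors τ B (a * x)⟩ := fun x =>
    Subtype.ext (leftMul_vec τ a x)
  rw [← hl]
  -- Boundedness is inherited from the left action on `H^E`, transported by the unitary; every
  -- bounded vector is some `vec τ x`, so testing on these suffices.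
  refine boundedExt_apply ⟨U.conjStarAlgEquiv (corrLeft τ (condExp τ B) a), ?_⟩
    ((⟨vec τ x, vec_mem_boundedVectors τ B x⟩, ξ) : boundedVectors τ (B : Set A) × L2 τ)
  rintro ⟨⟨ζ, hζ⟩, ξ⟩
  obtain ⟨x, hx⟩ := h.exists_vec_eq ⟨ζ, hζ⟩
  change vec τ x = ζ at hx
  subst hx
  change U.conjStarAlgEquiv _ (tmul τ (B : Set A) ⟨vec τ x, _⟩ ξ) =
    tmul τ (B : Set A) ⟨leftMul τ a (vec τ x), _⟩ ξ
  rw [LinearIsometryEquiv.conjStarAlgEquiv_apply_apply, ← hU x, U.symm_apply_apply,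
    h.corrLeft_symb, hU, hl]

theorem tensorRight_tmul (b x : A) (ξ : L2 τ) :
    tensorRight τ (B : Set A) b (tmul τ B ⟨vec τ x, vec_mem_boundedVectors τ B x⟩ ξ) =
      tmul τ (B : Set A) ⟨vec τ x, vec_mem_boundedVectors τ B x⟩ (rightMul τ b ξ) := by
  obtain ⟨U, hU⟩ := h.exists_unitary
  refine boundedExt_apply ⟨U.conjStarAlgEquiv (corrRight τ (condExp τ B) b), ?_⟩
    ((⟨vec τ x, vec_mem_boundedVectors τ B x⟩, ξ) : boundedVectors τ (B : Set A) × L2 τ)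
  rintro ⟨⟨ζ, hζ⟩, ξ⟩
  obtain ⟨x, hx⟩ := h.exists_vec_eq ⟨ζ, hζ⟩
  change vec τ x = ζ at hx
  subst hx
  change U.conjStarAlgEquiv _ (tmul τ (B : Set A) ⟨vec τ x, _⟩ ξ) =
    tmul τ (B : Set A) ⟨vec τ x, _⟩ (rightMul τ b ξ)
  rw [LinearIsometryEquiv.conjStarAlgEquiv_apply_apply, ← hU x, U.symm_apply_apply,
    h.corrRight_symb, hU]

theorem tensorLeft_tvec (a x y : A) :
    tensorLeft τ (B : Set A) a (tvec τ B x y) = tvec τ B (a * x) y :=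
  h.tensorLeft_tmul a x (vec τ y)

theorem tensorRight_tvec (b x y : A) :
    tensorRight τ (B : Set A) b (tvec τ B x y) = tvec τ B x (y * b) := by
  rw [tvec, h.tensorRight_tmul, rightMul_vec h.tracial]
  rfl

theorem inner_tvec (x y x' y' : A) : ⟪tvec τ (B : Set A) x y, tvec τ B x' y'⟫_ℂ =
    τ (star y * condExp τ B (star x * x') * y') := by
  rw [tvec, tvec, h.inner_tmul, leftMul_vec, inner_vec, mul_assoc]

theorem adjoint_tensorRight (b : A) :
    ContinuousLinearMap.adjoint (tensorRight τ (B : Set A) b) = tensorRight τ B (star b) :=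
  h.isTotal_tmul.adjoint_eq fun p q => by
    rw [h.tensorRight_tmul, h.tensorRight_tmul, h.inner_tmul, h.inner_tmul,
      inner_rightMul_left h.tracial, leftMul_rightMul_comm]

theorem isTotal_tvec : IsTotal fun p : A × A => tvec τ (B : Set A) p.1 p.2 := by
  let S := (Submodule.span ℂ (Set.range fun p : A × A => tvec τ (B : Set A) p.1 p.2))
  have hS : ∀ x ξ, tmul τ (B : Set A) ⟨vec τ x, vec_mem_boundedVectors τ B x⟩ ξ ∈
      S.topologicalClosure := fun x ξ => by
    refine (denseRange_vec τ).induction_on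
      (p := fun ξ => tmul τ (B : Set A) ⟨vec τ x, vec_mem_boundedVectors τ B x⟩ ξ ∈
        S.topologicalClosure) ξ ?_ fun y => ?_
    · exact S.isClosed_topologicalClosure.preimage
        (symb (tensorKernel τ (B : Set A)) ⟨vec τ x, vec_mem_boundedVectors τ B x⟩).continuous
    · exact S.le_topologicalClosure (Submodule.subset_span ⟨(x, y), rfl⟩)
  have hd := h.isTotal_tmul.mono (Submodule.span_le.mpr (by
    rintro _ ⟨p, rfl⟩
    exact hS p.1 p.2) : _ ≤ S.topologicalClosure)
  rw [Submodule.topologicalClosure_coe] at hd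
  exact dense_closure.mp hd

/-! ### The Jones projection and the index -/

omit h in
theorem span_vec_le : Submodule.span ℂ (vec τ '' B) ≤
    (Subalgebra.toSubmodule B.toSubalgebra).map (vecLM τ) :=
  Submodule.span_le.mpr (by rintro _ ⟨b, hb, rfl⟩; exact ⟨b, hb, rfl⟩)

theorem jonesProj_vec (x : A) : jonesProj τ (B : Set A) (vec τ x) = vec τ (condExp τ B x) := by
  have hc : IsClosed {ζ : L2 τ | ⟪vec τ x - vec τ (condExp τ B x), ζ⟫_ℂ = 0} :=
    isClosed_eq (by fun_prop) continuous_const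
  have : CompleteSpace (L2Sub τ (B : Set A)) :=
    (Submodule.isClosed_topologicalClosure _).completeSpace_coe
  refine Submodule.eq_starProjection_of_mem_of_inner_eq_zero (K := L2Sub τ (B : Set A))
    (Submodule.le_topologicalClosure _ (Submodule.subset_span ⟨_, h.isCondExp.mem x, rfl⟩))
    fun ζ hζ => closure_minimal (t := {ζ | ⟪vec τ x - vec τ (condExp τ B x), ζ⟫_ℂ = 0}) ?_ hc hζ
  intro ζ hζ
  obtain ⟨b, hb, rfl⟩ := span_vec_le hζ
  change ⟪vec τ x - vec τ (condExp τ B x), vec τ b⟫_ℂ = 0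
  rw [← inner_conj_symm, inner_sub_right, inner_vec, inner_vec,
    h.trace_mul_condExp (star_mem hb), sub_self, map_zero]

theorem jonesProj_rightMul {b : A} (hb : b ∈ B) (ξ : L2 τ) :
    jonesProj τ (B : Set A) (rightMul τ b ξ) = rightMul τ b (jonesProj τ (B : Set A) ξ) :=
  DFunLike.congr_fun ((isTotal_vec τ).commute (S := jonesProj τ (B : Set A))
    (T := rightMul τ b) fun x => by
      rw [rightMul_vec h.tracial, h.jonesProj_vec, h.jonesProj_vec, rightMul_vec h.tracial,
        h.condExp_right hb]).eq ξ

theorem exists_isModuleDim : ∃ d, IsModuleDim τ (B : Set A) d := by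
  obtain ⟨V, hV⟩ := (isTotal_vec τ).exists_linearIsometry
    (g := fun x => WithLp.toLp 2 fun k => vec τ (condExp τ B (star (η k) * x)))
    fun x y => by
      simp only [PiLp.inner_apply, inner_vec]
      rw [← map_sum, ← h.condExp_star_mul, h.isCondExp.trace]
  refine ⟨_, n, V, fun ξ i => ?_, fun b hb ξ i => ?_, rfl⟩
  · refine (denseRange_vec τ).induction_on (p := fun ξ => V ξ i ∈ L2Sub τ (B : Set A)) ξ ?_
      fun x => ?_
    · exact (Submodule.isClosed_topologicalClosure _).preimage (by fun_prop)
    · rw [hV]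
      exact Submodule.le_topologicalClosure _
        (Submodule.subset_span ⟨_, h.isCondExp.mem _, rfl⟩)
  · refine (denseRange_vec τ).induction_on
      (p := fun ξ => V (rightMul τ b ξ) i = rightMul τ b (V ξ i)) ξ ?_ fun x => ?_
    · exact isClosed_eq (by fun_prop) (by fun_prop)
    · rw [rightMul_vec h.tracial, hV, hV]
      simp only [rightMul_vec h.tracial, ← mul_assoc, h.condExp_right hb]

/-- The bound `‖V(Ω)ᵢ‖ ≤ ‖V* Ωᵢ‖` holds for each `i`, and `∑ᵢ ‖V(Ω)ᵢ‖² = ‖Ω‖² = 1`. -/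
theorem one_le_of_isModuleDim {d : ℝ} (hd : IsModuleDim τ (B : Set A) d) : 1 ≤ d := by
  obtain ⟨k, V, hV, hVb, rfl⟩ := hd
  have key : ∀ i, ‖V (vec τ 1) i‖ ≤
      ‖ContinuousLinearMap.adjoint V.toContinuousLinearMap (PiLp.single 2 i (vec τ 1))‖ := by
    intro i
    set w := ContinuousLinearMap.adjoint V.toContinuousLinearMap (PiLp.single 2 i (vec τ 1)) with hw
    have hc : IsClosed {ζ : L2 τ | ‖⟪V (vec τ 1) i, ζ⟫_ℂ‖ ≤ ‖w‖ * ‖ζ‖} :=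
      isClosed_le (by fun_prop) (by fun_prop)
    have h1 : ∀ ζ ∈ L2Sub τ (B : Set A), ‖⟪V (vec τ 1) i, ζ⟫_ℂ‖ ≤ ‖w‖ * ‖ζ‖ := by
      refine fun ζ hζ => closure_minimal ?_ hc hζ
      intro ζ hζ
      obtain ⟨b, hb, rfl⟩ := span_vec_le hζ
      have hb' : star b ∈ B := star_mem hb
      -- Right `B`-linearity of `V` moves `b` across: `⟪V(Ω)ᵢ, bΩ⟫ = ⟪V(b*Ω)ᵢ, Ω⟫ = ⟪b*Ω, V* Ωᵢ⟫`.
      -- As `V(Ω)ᵢ` lies in `L²(B)`, the resulting estimate may be applied to `V(Ω)ᵢ` itself.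
      have h3 : ⟪V (vec τ 1) i, vec τ b⟫_ℂ = ⟪vec τ (star b), w⟫_ℂ := by
        rw [hw, ContinuousLinearMap.adjoint_inner_right, ← one_mul b, ← rightMul_vec h.tracial,
          ← star_star b, ← inner_rightMul_left h.tracial, ← hVb _ hb', star_star, star_mul,
          rightMul_vec h.tracial, star_one, one_mul, PiLp.inner_apply, Finset.sum_eq_single i]
        · simp
        · intro j _ hj
          simp [hj]
        · simp
      change ‖⟪V (vec τ 1) i, vec τ b⟫_ℂ‖ ≤ ‖w‖ * ‖vec τ b‖
      rw [h3, ← norm_vec_star h.tracial b, mul_comm]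
      exact norm_inner_le_norm _ _
    have h4 := h1 _ (hV (vec τ 1) i)
    rw [inner_self_eq_norm_sq_to_K, sq] at h4
    have h5 : ‖V (vec τ 1) i‖ * ‖V (vec τ 1) i‖ ≤ ‖w‖ * ‖V (vec τ 1) i‖ := by simpa using h4
    rcases (norm_nonneg (V (vec τ 1) i)).eq_or_lt with h0 | h0
    · rw [← h0]; exact norm_nonneg _
    · exact le_of_mul_le_mul_right h5 h0
  have hΩ : ‖vec τ 1‖ ^ 2 = 1 := by
    have h6 := norm_vec_sq τ (1 : A)
    rw [star_one, one_mul, h.normalized] at h6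
    exact_mod_cast h6
  calc (1 : ℝ) = ‖V (vec τ 1)‖ ^ 2 := by rw [V.norm_map, hΩ]
    _ = ∑ i, ‖V (vec τ 1) i‖ ^ 2 := PiLp.norm_sq_eq_of_L2 _ _
    _ ≤ _ := Finset.sum_le_sum fun i _ => pow_le_pow_left₀ (norm_nonneg _) (key i) 2

/-- An embedding must be exhibited as well, since the infimum of the empty set would be `0`. -/
theorem one_le_jonesIndex : 1 ≤ jonesIndex τ (B : Set A) :=
  le_csInf h.exists_isModuleDim fun _ hd => h.one_le_of_isModuleDim hd

theorem delta_pos : 0 < delta τ (B : Set A) :=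
  Real.sqrt_pos.mpr (zero_lt_one.trans_le h.one_le_jonesIndex)

theorem delta_mul_delta : delta τ (B : Set A) * delta τ (B : Set A) = jonesIndex τ B :=
  Real.mul_self_sqrt (zero_le_one.trans h.one_le_jonesIndex)

/-! ### The basic construction -/

theorem mem_basicConstruction_iff {z : L2 τ →L[ℂ] L2 τ} : z ∈ basicConstruction τ (B : Set A) ↔
    ∀ b ∈ B, ∀ ξ, rightMul τ b (z ξ) = z (rightMul τ b ξ) := by
  change z ∈ StarSubalgebra.centralizer ℂ (rightMul τ '' (B : Set A)) ↔ _
  rw [StarSubalgebra.mem_centralizer_iff]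
  constructor
  · exact fun hz b hb ξ => DFunLike.congr_fun (hz _ ⟨b, hb, rfl⟩).1 ξ
  · rintro hz _ ⟨b, hb, rfl⟩
    refine ⟨ContinuousLinearMap.ext fun ξ => hz b hb ξ, ?_⟩
    rw [ContinuousLinearMap.star_eq_adjoint, adjoint_rightMul h.tracial]
    exact ContinuousLinearMap.ext fun ξ => hz _ (star_mem hb) ξ

theorem leftMul_mul_jonesProj_mul_leftMul_mem (x y : A) :
    leftMul τ x * jonesProj τ (B : Set A) * leftMul τ y ∈ basicConstruction τ (B : Set A) :=
  h.mem_basicConstruction_iff.mpr fun b hb ξ => by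
    change rightMul τ b (leftMul τ x (jonesProj τ (B : Set A) (leftMul τ y ξ))) =
      leftMul τ x (jonesProj τ (B : Set A) (leftMul τ y (rightMul τ b ξ)))
    rw [leftMul_rightMul_comm, h.jonesProj_rightMul hb, leftMul_rightMul_comm]

/-- The element `x e y` of the basic construction. -/
def jonesMul (x y : A) : basicConstruction τ (B : Set A) :=
  ⟨leftMul τ x * jonesProj τ (B : Set A) * leftMul τ y,
    h.leftMul_mul_jonesProj_mul_leftMul_mem x y⟩

theorem jonesMul_vec (x y a : A) :
    (h.jonesMul x y : L2 τ →L[ℂ] L2 τ) (vec τ a) = vec τ (x * condExp τ B (y * a)) := by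
  change leftMul τ x (jonesProj τ (B : Set A) (leftMul τ y (vec τ a))) = _
  rw [leftMul_vec, h.jonesProj_vec, leftMul_vec]

theorem incl_mul_jonesMul (a x y : A) :
    incl τ (B : Set A) a * h.jonesMul x y = h.jonesMul (a * x) y :=
  Subtype.ext ((isTotal_vec τ).ext fun c => by
    change leftMul τ a ((h.jonesMul x y : L2 τ →L[ℂ] L2 τ) (vec τ c)) = _
    rw [h.jonesMul_vec, h.jonesMul_vec, leftMul_vec, mul_assoc])

theorem jonesMul_mul_incl (a x y : A) :
    h.jonesMul x y * incl τ (B : Set A) a = h.jonesMul x (y * a) :=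
  Subtype.ext ((isTotal_vec τ).ext fun c => by
    change (h.jonesMul x y : L2 τ →L[ℂ] L2 τ) (leftMul τ a (vec τ c)) = _
    rw [leftMul_vec, h.jonesMul_vec, h.jonesMul_vec, mul_assoc])

/-- Right `B`-linearity makes each `z(ηⱼΩ)` a bounded vector, hence some `mⱼΩ`, and then `z(xΩ) = ∑ⱼ
z(ηⱼΩ) E(ηⱼ* x) = ∑ⱼ mⱼ E(ηⱼ* x)Ω`. The elements `x e y` therefore span the basic construction
without any closure. -/
theorem exists_eq_sum_jonesMul (z : basicConstruction τ (B : Set A)) :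
    ∃ m : Fin n → A, z = ∑ j, h.jonesMul (m j) (star (η j)) := by
  have hz := h.mem_basicConstruction_iff.mp z.2
  have hm : ∀ j, ∃ m, vec τ m = (z : L2 τ →L[ℂ] L2 τ) (vec τ (η j)) := fun j => by
    refine h.exists_vec_of_bounded (c := ‖(z : L2 τ →L[ℂ] L2 τ)‖ * ‖leftMul τ (η j)‖)
      fun b hb => ?_
    rw [hz b hb, rightMul_vec h.tracial, ← leftMul_vec, mul_assoc]
    exact (ContinuousLinearMap.le_opNorm _ _).trans
      (mul_le_mul_of_nonneg_left (ContinuousLinearMap.le_opNorm _ _) (norm_nonneg _))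
  choose m hm using hm
  refine ⟨m, Subtype.ext ((isTotal_vec τ).ext fun x => ?_)⟩
  have hs : ((∑ j, h.jonesMul (m j) (star (η j)) : basicConstruction τ (B : Set A)) :
      L2 τ →L[ℂ] L2 τ) = ∑ j, (h.jonesMul (m j) (star (η j)) : L2 τ →L[ℂ] L2 τ) :=
    AddSubmonoidClass.coe_finsetSum _ _
  rw [hs, _root_.sum_apply]
  conv_lhs => rw [← h.basis x, vec_sum, map_sum]
  refine Finset.sum_congr rfl fun j _ => ?_
  rw [h.jonesMul_vec, ← rightMul_vec h.tracial, ← hz _ (h.isCondExp.mem _), ← hm,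
    rightMul_vec h.tracial]

theorem mem_span_jonesMul (z : basicConstruction τ (B : Set A)) :
    z ∈ Submodule.span ℂ (Set.range fun p : A × A => h.jonesMul p.1 p.2) := by
  obtain ⟨m, rfl⟩ := h.exists_eq_sum_jonesMul z
  exact Submodule.sum_mem _ fun j _ => Submodule.subset_span ⟨(m j, star (η j)), rfl⟩

/-- Invariance of `τ` under `E`, together with traciality, turns the `j`-th term into `τ(y* E(x* x')
E(y' ηⱼ) ηⱼ*)`; summing over `j` collapses the basis to `y'`. -/
theorem inner_vec_jonesMul (x y x' y' : A) :
    ⟪vec (canonicalTrace τ (B : Set A) η) (h.jonesMul x y),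
      vec (canonicalTrace τ (B : Set A) η) (h.jonesMul x' y')⟫_ℂ =
    ((jonesIndex τ (B : Set A))⁻¹ : ℝ) * τ (star y * condExp τ B (star x * x') * y') := by
  rw [inner_vec]
  change (((jonesIndex τ (B : Set A))⁻¹ : ℝ) : ℂ) * ∑ j, ⟪vec τ (η j),
    (star (h.jonesMul x y : L2 τ →L[ℂ] L2 τ) * (h.jonesMul x' y' : L2 τ →L[ℂ] L2 τ))
      (vec τ (η j))⟫_ℂ = _
  congr 1
  have h1 : ∀ j, ⟪vec τ (η j), (star (h.jonesMul x y : L2 τ →L[ℂ] L2 τ) *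
      (h.jonesMul x' y' : L2 τ →L[ℂ] L2 τ)) (vec τ (η j))⟫_ℂ =
      τ (star y * condExp τ B (star x * x') * (condExp τ B (y' * η j) * star (η j))) := fun j => by
    rw [ContinuousLinearMap.star_eq_adjoint]
    change ⟪vec τ (η j), ContinuousLinearMap.adjoint (h.jonesMul x y : L2 τ →L[ℂ] L2 τ)
      ((h.jonesMul x' y' : L2 τ →L[ℂ] L2 τ) (vec τ (η j)))⟫_ℂ = _
    rw [ContinuousLinearMap.adjoint_inner_right, h.jonesMul_vec, h.jonesMul_vec, inner_vec]
    calc τ (star (x * condExp τ B (y * η j)) * (x' * condExp τ B (y' * η j)))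
        = τ (condExp τ B (star (condExp τ B (y * η j)) * (star x * x') *
            condExp τ B (y' * η j))) := by
          rw [h.isCondExp.trace, star_mul]; simp only [mul_assoc]
      _ = τ (condExp τ B (star x * x') * condExp τ B (y' * η j) * condExp τ B (star (y * η j))) := by
          rw [h.isCondExp.bimodule _ (star_mem (h.isCondExp.mem _)) _ (h.isCondExp.mem _),
            mul_assoc, h.tracial, h.condExp_star]
      _ = τ (condExp τ B (star x * x') * condExp τ B (y' * η j) * star (y * η j)) :=
          h.trace_mul_condExp (mul_mem (h.isCondExp.mem _) (h.isCondExp.mem _)) _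
      _ = _ := by
          rw [star_mul, ← mul_assoc, h.tracial]; simp only [mul_assoc]
  simp only [h1]
  rw [← map_sum, ← Finset.mul_sum, h.sum_right]

theorem inner_delta_smul_vec_jonesMul (x y x' y' : A) :
    ⟪(delta τ (B : Set A) : ℂ) • vec (canonicalTrace τ (B : Set A) η) (h.jonesMul x y),
      (delta τ (B : Set A) : ℂ) • vec (canonicalTrace τ (B : Set A) η) (h.jonesMul x' y')⟫_ℂ =
    ⟪tvec τ (B : Set A) x y, tvec τ B x' y'⟫_ℂ := by
  have h0 : jonesIndex τ (B : Set A) ≠ 0 := (zero_lt_one.trans_le h.one_le_jonesIndex).ne'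
  rw [inner_smul_left, inner_smul_right, h.inner_vec_jonesMul, h.inner_tvec, Complex.conj_ofReal,
    ← mul_assoc, ← mul_assoc, ← Complex.ofReal_mul, h.delta_mul_delta, ← Complex.ofReal_mul,
    mul_inv_cancel₀ h0, Complex.ofReal_one, one_mul]

theorem isTotal_delta_smul_vec_jonesMul : IsTotal fun p : A × A =>
    (delta τ (B : Set A) : ℂ) • vec (canonicalTrace τ (B : Set A) η) (h.jonesMul p.1 p.2) := by
  have h0 : (delta τ (B : Set A) : ℂ) ≠ 0 := Complex.ofReal_ne_zero.mpr h.delta_pos.ne'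
  refine (isTotal_vec (canonicalTrace τ (B : Set A) η)).mono (Submodule.span_le.mpr ?_)
  rintro _ ⟨z, rfl⟩
  obtain ⟨m, rfl⟩ := h.exists_eq_sum_jonesMul z
  rw [vec_sum]
  refine Submodule.sum_mem _ fun j _ => ?_
  rw [← one_smul ℂ (vec _ (h.jonesMul (m j) (star (η j)))), ← inv_mul_cancel₀ h0, mul_smul]
  exact Submodule.smul_mem _ _ (Submodule.subset_span ⟨(m j, star (η j)), rfl⟩)

theorem exists_unitary_jonesMul :
    ∃ κ : L2 (canonicalTrace τ (B : Set A) η) ≃ₗᵢ[ℂ] RelTensor τ (B : Set A),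
      ∀ x y, κ ((delta τ (B : Set A) : ℂ) •
        vec (canonicalTrace τ (B : Set A) η) (h.jonesMul x y)) = tvec τ B x y := by
  obtain ⟨κ, hκ⟩ := h.isTotal_delta_smul_vec_jonesMul.exists_linearIsometryEquiv h.isTotal_tvec
    fun p q => h.inner_delta_smul_vec_jonesMul p.1 p.2 q.1 q.2
  exact ⟨κ, fun x y => hκ (x, y)⟩

section Unitary

variable {κ : L2 (canonicalTrace τ (B : Set A) η) ≃ₗᵢ[ℂ] RelTensor τ (B : Set A)}
  (hκ : ∀ x y, κ ((delta τ (B : Set A) : ℂ) •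
    vec (canonicalTrace τ (B : Set A) η) (h.jonesMul x y)) = tvec τ B x y)

include hκ

theorem map_vec_jonesMul (x y : A) :
    κ (vec (canonicalTrace τ (B : Set A) η) (h.jonesMul x y)) =
      (delta τ (B : Set A) : ℂ)⁻¹ • tvec τ B x y := by
  have h0 : (delta τ (B : Set A) : ℂ) ≠ 0 := Complex.ofReal_ne_zero.mpr h.delta_pos.ne'
  rw [← hκ, map_smul, inv_smul_smul₀ h0]

theorem map_leftMul_incl (a : A) (ξ : L2 (canonicalTrace τ (B : Set A) η)) :
    κ (leftMul (canonicalTrace τ (B : Set A) η) (incl τ B a) ξ) = tensorLeft τ B a (κ ξ) :=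
  map_leftMul_of_forall h.mem_span_jonesMul (fun p => by
    rw [h.map_vec_jonesMul hκ, map_smul, h.tensorLeft_tvec, h.incl_mul_jonesMul,
      h.map_vec_jonesMul hκ]) ξ

theorem map_rightMul_incl (a : A) (ξ : L2 (canonicalTrace τ (B : Set A) η)) :
    κ (rightMul (canonicalTrace τ (B : Set A) η) (incl τ B a) ξ) = tensorRight τ B a (κ ξ) :=
  map_rightMul_of_forall h.mem_span_jonesMul (fun p => by
    rw [h.map_vec_jonesMul hκ, map_smul, h.tensorRight_tvec, h.jonesMul_mul_incl,
      h.map_vec_jonesMul hκ]) ξ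

/-- The commutant in `basicConstruction` also involves adjoints of right multiplications. These are
computed on the relative tensor product through `κ`, which avoids proving that the canonical trace
is tracial. -/
theorem relativeCommutant_eq : relativeCommutant τ (B : Set A) η =
    bimoduleEnd (fun a => leftMul (canonicalTrace τ (B : Set A) η) (incl τ B a))
      (fun a => rightMul (canonicalTrace τ (B : Set A) η) (incl τ B a)) := by
  have hadj : ∀ a, star (rightMul (canonicalTrace τ (B : Set A) η) (incl τ B a)) =
      rightMul (canonicalTrace τ (B : Set A) η) (incl τ B (star a)) := fun a =>
    star_eq_of_intertwine (h.map_rightMul_incl hκ a) fun ξ => by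
      rw [h.adjoint_tensorRight, h.map_rightMul_incl hκ]
  ext T
  refine and_comm.trans (and_congr_right fun _ => ?_)
  change T ∈ StarSubalgebra.centralizer ℂ _ ↔ _
  rw [StarSubalgebra.mem_centralizer_iff]
  constructor
  · exact fun hT b => (hT _ ⟨_, ⟨b, rfl⟩, rfl⟩).1
  · rintro hT _ ⟨_, ⟨b, rfl⟩, rfl⟩
    refine ⟨hT b, ?_⟩
    rw [hadj]
    exact hT (star b)

end Unitary

/-! ### The Fourier multiplier -/

variable {Φ : A →CP A} (hΦ : ∀ a ∈ B, ∀ b ∈ B, ∀ x, Φ (a * x * b) = a * Φ x * b)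
  {U : Corr τ (condExp τ B) ≃ₗᵢ[ℂ] RelTensor τ (B : Set A)}
  (hU : ∀ x ξ, U (symb (corrKernel τ (condExp τ B)) x ξ) =
      tmul τ (B : Set A) ⟨vec τ x, vec_mem_boundedVectors τ B x⟩ ξ)

include hΦ hU

theorem conj_derivative_tvec (x y : A) :
    U.conjStarAlgEquiv (derivative τ Φ.toLinearMap (condExp τ B)) (tvec τ B x y) =
      ∑ j, tvec τ B (x * η j) (Φ (star (η j)) * y) := by
  rw [LinearIsometryEquiv.conjStarAlgEquiv_apply_apply, tvec, ← hU, U.symm_apply_apply,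
    h.derivative_symb hΦ, map_sum]
  refine Finset.sum_congr rfl fun j _ => ?_
  rw [hU, leftMul_vec]
  rfl

omit hU in
theorem isFourierMultiplier : IsFourierMultiplier τ (B : Set A) η Φ.toLinearMap
    (fourierMultiplier τ (B : Set A) η Φ.toLinearMap) := by
  obtain ⟨U, hU⟩ := h.exists_unitary
  refine fun x y => boundedExt_apply ⟨((delta τ (B : Set A) : ℂ)⁻¹) •
    U.conjStarAlgEquiv (derivative τ Φ.toLinearMap (condExp τ B)), fun p => ?_⟩ (x, y)
  exact congrArg (((delta τ (B : Set A) : ℂ)⁻¹) • ·) (h.conj_derivative_tvec hΦ hU p.1 p.2)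

theorem conj_derivative_eq : U.conjStarAlgEquiv (derivative τ Φ.toLinearMap (condExp τ B)) =
    (delta τ (B : Set A) : ℂ) • fourierMultiplier τ (B : Set A) η Φ.toLinearMap := by
  have h0 : (delta τ (B : Set A) : ℂ) ≠ 0 := Complex.ofReal_ne_zero.mpr h.delta_pos.ne'
  refine h.isTotal_tvec.ext fun p => ?_
  rw [h.conj_derivative_tvec hΦ hU]
  change _ = (delta τ (B : Set A) : ℂ) • fourierMultiplier τ (B : Set A) η Φ.toLinearMap _
  rw [h.isFourierMultiplier hΦ, smul_inv_smul₀ h0]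
  rfl

end IsFiniteInclusion

end Subfactor

namespace Subfactor

/-! ### Bounded vectors of a von Neumann algebra with a normal trace -/

section Separation

variable {A : Type u} [CStarAlgebra A] [PartialOrder A] [StarOrderedRing A] {τ : A →ₚ[ℂ] ℂ}

theorem norm_le_one_of_star_mul_le {x : A} (hx : star x * x ≤ 1) : ‖x‖ ≤ 1 := by
  have h1 : ‖star x * x‖ ≤ 1 :=
    (CStarAlgebra.norm_le_one_iff_of_nonneg _ (star_mul_self_nonneg x)).mpr hx
  rw [CStarRing.norm_star_mul_self] at h1
  nlinarith [norm_nonneg x]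

/-- An approximate polar decomposition `b = u h`, with `h = g²` and `h² = b* b + ε²`. -/
theorem exists_approx_polar (b : A) {ε : ℝ} (hε : 0 < ε) : ∃ u g i : A, ‖u‖ ≤ 1 ∧ ‖i‖ ≤ 1 ∧
    star g = g ∧ b = u * g * g ∧ star b * u = g * g - ε • i := by
  have hs0 : 0 ≤ star b * b := star_mul_self_nonneg b
  have hε2 : (0 : A) ≤ algebraMap ℝ A (ε ^ 2) := algebraMap_nonneg A (by positivity)
  have hs : 0 ≤ star b * b + algebraMap ℝ A (ε ^ 2) := add_nonneg hs0 hε2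
  have hsu : IsUnit (star b * b + algebraMap ℝ A (ε ^ 2)) := by
    exact CStarAlgebra.isUnit_of_le (algebraMap ℝ A (ε ^ 2)) (le_add_of_nonneg_left hs0)
      ⟨hε2, (isUnit_iff_ne_zero.mpr (by positivity)).map (algebraMap ℝ A)⟩
  set h := CFC.sqrt (star b * b + algebraMap ℝ A (ε ^ 2)) with hh
  have h0 : 0 ≤ h := CFC.sqrt_nonneg _
  have hsq : h * h = star b * b + algebraMap ℝ A (ε ^ 2) := CFC.sqrt_mul_sqrt_self _ hs
  have hsa : star h = h := (IsSelfAdjoint.of_nonneg h0).star_eq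
  have hu : IsUnit h := by
    have h1 : IsUnit (h * h) := hsq ▸ hsu
    exact ((Commute.refl h).isUnit_mul_iff.mp h1).1
  obtain ⟨k, hk⟩ := hu
  have hki : (k : A) * ↑k⁻¹ = 1 := k.mul_inv
  have hik : (↑k⁻¹ : A) * k = 1 := k.inv_mul
  rw [hk] at hki hik
  set i : A := ↑k⁻¹ with hi
  have hisa : star i = i := by
    have h2 : star i * h = 1 := by rw [← hsa, ← star_mul, hki, star_one]
    calc star i = star i * (h * i) := by rw [hki, mul_one]
      _ = i := by rw [← mul_assoc, h2, one_mul]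
  have hg : CFC.sqrt h * CFC.sqrt h = h := CFC.sqrt_mul_sqrt_self _ h0
  have hbb : star b * b = h * h - algebraMap ℝ A (ε ^ 2) := by rw [hsq, add_sub_cancel_right]
  have hbi : star b * (b * i) = h - ε • (ε • i) := by
    rw [← mul_assoc, hbb, sub_mul, mul_assoc, hki, mul_one, ← Algebra.smul_def, sq, mul_smul]
  -- With `i = h⁻¹`, this is `h⁻¹ (b* b + ε²) h⁻¹ = 1`; it bounds both `u = b h⁻¹` and `ε h⁻¹` by
  -- `1`.
  have huu : star (b * i) * (b * i) + star (ε • i) * (ε • i) = 1 := by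
    rw [star_mul, mul_assoc, hbi, star_smul, hisa, star_trivial, mul_sub, hik, smul_mul_assoc,
      mul_smul_comm, mul_smul_comm, sub_add_cancel]
  refine ⟨b * i, CFC.sqrt h, ε • i, norm_le_one_of_star_mul_le ?_, norm_le_one_of_star_mul_le ?_,
    (IsSelfAdjoint.of_nonneg (CFC.sqrt_nonneg h)).star_eq, ?_, ?_⟩
  · rw [← huu]
    exact le_add_of_nonneg_right (star_mul_self_nonneg _)
  · rw [← huu]
    exact le_add_of_nonneg_left (star_mul_self_nonneg _)
  · rw [mul_assoc, hg, mul_assoc, hik, mul_one]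
  · rw [hg, hbi]

theorem norm_vec_one (h1 : τ 1 = 1) : ‖vec τ 1‖ = 1 := by
  have h2 := norm_vec_sq τ (1 : A)
  rw [star_one, one_mul, h1] at h2
  have h3 : ‖vec τ 1‖ ^ 2 = 1 := by exact_mod_cast h2
  exact (pow_eq_one_iff_of_nonneg (norm_nonneg _) two_ne_zero).mp h3

theorem norm_vec_mul_le (a b : A) : ‖vec τ (a * b)‖ ≤ ‖a‖ * ‖vec τ b‖ := by
  rw [← leftMul_vec]
  exact (ContinuousLinearMap.le_opNorm _ _).trans
    (mul_le_mul_of_nonneg_right (norm_leftMul_le τ a) (norm_nonneg _))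

theorem norm_vec_le (h1 : τ 1 = 1) (a : A) : ‖vec τ a‖ ≤ ‖a‖ := by
  simpa [norm_vec_one h1] using norm_vec_mul_le (τ := τ) a 1

/-- With `b = u g g`, moving one `g` to the right of `ξ` gives `Re ⟪bΩ, ξ⟫ ≤ c τ(g²)`. The choice `a
= c u` attains this up to `c ε`, because `b* u = g² - ε i`. It is the duality between the 1-norm and
the operator norm in approximate form. -/
theorem re_inner_vec_le (h1 : τ 1 = 1) (ht : ∀ x y, τ (x * y) = τ (y * x)) {ξ : L2 τ} {c : ℝ}
    (hc : 0 ≤ c) (hξ : ∀ b, ‖rightMul τ b ξ‖ ≤ c * ‖vec τ b‖) (b : A) {ε : ℝ} (hε : 0 < ε) :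
    ∃ a, ‖a‖ ≤ c ∧ (⟪vec τ b, ξ⟫_ℂ).re ≤ (⟪vec τ b, vec τ a⟫_ℂ).re + c * ε := by
  obtain ⟨u, g, i, hu, hi, hg, hb, hbu⟩ := exists_approx_polar b hε
  refine ⟨(c : ℂ) • u, ?_, ?_⟩
  · rw [norm_smul, Complex.norm_real, Real.norm_of_nonneg hc]
    exact mul_le_of_le_one_right hc hu
  · have hτi : (τ i).re ≤ 1 := by
      have h2 : τ i = ⟪vec τ 1, vec τ i⟫_ℂ := by rw [inner_vec, star_one, one_mul]
      refine (Complex.re_le_norm _).trans ?_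
      rw [h2]
      refine (norm_inner_le_norm _ _).trans ?_
      rw [norm_vec_one h1, one_mul]
      exact (norm_vec_le h1 i).trans hi
    have hgg : (τ (g * g)).re = ‖vec τ g‖ ^ 2 := by
      have h3 := norm_vec_sq τ g
      rw [hg] at h3
      rw [← h3, Complex.ofReal_re]
    have hr : (⟪vec τ b, vec τ ((c : ℂ) • u)⟫_ℂ).re = c * (‖vec τ g‖ ^ 2 - ε * (τ i).re) := by
      rw [vec_smul, inner_smul_right, inner_vec, hbu, map_sub, ← Complex.coe_smul, map_smul,
        Complex.re_ofReal_mul, Complex.sub_re, hgg, smul_eq_mul, Complex.re_ofReal_mul]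
    have hl : (⟪vec τ b, ξ⟫_ℂ).re ≤ c * ‖vec τ g‖ ^ 2 := by
      rw [hb, ← rightMul_vec ht, inner_rightMul_left ht, hg]
      refine (Complex.re_le_norm _).trans ((norm_inner_le_norm _ _).trans ?_)
      calc ‖vec τ (u * g)‖ * ‖rightMul τ g ξ‖ ≤ (1 * ‖vec τ g‖) * (c * ‖vec τ g‖) := by
            refine mul_le_mul ((norm_vec_mul_le u g).trans ?_) (hξ g) (norm_nonneg _)
              (by positivity)
            exact mul_le_mul_of_nonneg_right hu (norm_nonneg _)
        _ = _ := by ring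
    rw [hr]
    have h4 : c * (ε * (τ i).re) ≤ c * (ε * 1) :=
      mul_le_mul_of_nonneg_left (mul_le_mul_of_nonneg_left hτi hε.le) hc
    linarith

/-- A bounded vector is a limit of vectors `aΩ` with `a` in a fixed ball. -/
theorem mem_closure_vec_ball (h1 : τ 1 = 1) (ht : ∀ x y, τ (x * y) = τ (y * x)) {ξ : L2 τ} {c : ℝ}
    (hc : 0 ≤ c) (hξ : ∀ b, ‖rightMul τ b ξ‖ ≤ c * ‖vec τ b‖) :
    ξ ∈ closure (vec τ '' Metric.closedBall 0 c) := by
  by_contra hn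
  have hconv : Convex ℝ (closure (vec τ '' Metric.closedBall 0 c)) := by
    have h2 : Convex ℝ (((vecLM τ).restrictScalars ℝ) '' Metric.closedBall 0 c) :=
      (convex_closedBall 0 c).linear_image _
    exact h2.closure
  obtain ⟨f, u, hf, hu⟩ := RCLike.geometric_hahn_banach_closed_point (𝕜 := ℂ) hconv
    isClosed_closure hn
  set ζ := (InnerProductSpace.toDual ℂ (L2 τ)).symm f with hζ
  have hfζ : ∀ v, f v = ⟪ζ, v⟫_ℂ := fun v => by
    rw [hζ, InnerProductSpace.toDual_symm_apply]
  -- Three errors, each at most `d`, must fit in the gap `4d`: replacing `ζ` by `bΩ` at `ξ` and at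
  -- `aΩ`, and the loss from the approximate polar decomposition.
  set d := (RCLike.re (f ξ) - u) / 4 with hd
  have hd0 : 0 < d := by rw [hd]; linarith
  obtain ⟨b, hb⟩ : ∃ b, ‖ζ - vec τ b‖ * (‖ξ‖ + c + 1) < d := by
    obtain ⟨b, hb⟩ := (denseRange_vec τ).exists_dist_lt ζ
      (show 0 < d / (‖ξ‖ + c + 1) by positivity)
    refine ⟨b, ?_⟩
    rw [dist_eq_norm] at hb
    exact (lt_div_iff₀ (by positivity)).mp hb
  have hclose : ∀ v : L2 τ, ‖v‖ ≤ ‖ξ‖ + c + 1 → |(⟪ζ, v⟫_ℂ).re - (⟪vec τ b, v⟫_ℂ).re| < d := by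
    intro v hv
    rw [← Complex.sub_re, ← inner_sub_left]
    refine (Complex.abs_re_le_norm _).trans_lt ((norm_inner_le_norm _ _).trans_lt ?_)
    exact (mul_le_mul_of_nonneg_left hv (norm_nonneg _)).trans_lt hb
  obtain ⟨a, hac, ha⟩ := re_inner_vec_le h1 ht hc hξ b
    (show 0 < d / (c + 1) by positivity)
  have h3 : c * (d / (c + 1)) ≤ d := by
    rw [← mul_div_assoc, div_le_iff₀ (by positivity)]
    nlinarith
  have h4 : (f (vec τ a)).re < u :=
    hf _ (subset_closure ⟨a, mem_closedBall_zero_iff.mpr hac, rfl⟩)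
  rw [hfζ] at h4
  have h5 := hclose (vec τ a) (((norm_vec_le h1 a).trans hac).trans (by linarith [norm_nonneg ξ]))
  have h6 := hclose ξ (by linarith)
  have h7 : 4 * d = (⟪ζ, ξ⟫_ℂ).re - u := by
    rw [hd, hfζ]
    simp only [RCLike.re_eq_complex_re]
    ring
  rw [abs_lt] at h5 h6
  linarith [h5.1, h5.2, h6.1, h6.2]

end Separation

/-! ### Weak operator limits of bounded families -/

section WeakLimit

variable {ι H : Type*} [NormedAddCommGroup H] [InnerProductSpace ℂ H] [CompleteSpace H]

open Filter Topology

/-- Bounded nets of operators converge in the weak operator topology along ultrafilters. -/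
theorem exists_weak_limit (F : Ultrafilter ι) {T : ι → H →L[ℂ] H} {c : ℝ}
    (hT : ∀ i, ‖T i‖ ≤ c) :
    ∃ S : H →L[ℂ] H, ∀ x y, Tendsto (fun i => ⟪x, T i y⟫_ℂ) F (𝓝 ⟪x, S y⟫_ℂ) := by
  have hb : ∀ x y i, ‖⟪x, T i y⟫_ℂ‖ ≤ c * ‖x‖ * ‖y‖ := fun x y i => by
    refine (norm_inner_le_norm _ _).trans ?_
    have h1 := (T i).le_of_opNorm_le (hT i) y
    calc ‖x‖ * ‖T i y‖ ≤ ‖x‖ * (c * ‖y‖) := mul_le_mul_of_nonneg_left h1 (norm_nonneg _)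
      _ = _ := by ring
  have hlim : ∀ x y, ∃ z, Tendsto (fun i => ⟪x, T i y⟫_ℂ) F (𝓝 z) := fun x y => by
    obtain ⟨z, -, hz⟩ := (isCompact_closedBall (0 : ℂ) (c * ‖x‖ * ‖y‖)).ultrafilter_le_nhds
      (F.map fun i => ⟪x, T i y⟫_ℂ) (by
        rw [le_principal_iff]
        exact Filter.mem_map.mpr (Filter.univ_mem' fun i => mem_closedBall_zero_iff.mpr (hb x y i)))
    exact ⟨z, hz⟩
  choose ℓ hℓ using hlim
  have hℓb : ∀ x y, ‖ℓ x y‖ ≤ c * ‖x‖ * ‖y‖ := fun x y =>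
    le_of_tendsto (hℓ x y).norm (Eventually.of_forall fun i => hb x y i)
  -- The limits of the matrix coefficients form a bounded sesquilinear form, which is represented by
  -- an operator.
  let B : H →L⋆[ℂ] H →L[ℂ] ℂ := LinearMap.mkContinuous₂
    (LinearMap.mk₂'ₛₗ (starRingEnd ℂ) (RingHom.id ℂ) ℓ
      (fun x x' y => tendsto_nhds_unique (hℓ (x + x') y)
        (by simpa only [inner_add_left] using (hℓ x y).add (hℓ x' y)))
      (fun k x y => tendsto_nhds_unique (hℓ (k • x) y)
        (by simpa only [inner_smul_left, smul_eq_mul] using (hℓ x y).const_mul _))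
      (fun x y y' => tendsto_nhds_unique (hℓ x (y + y'))
        (by simpa only [map_add, inner_add_right] using (hℓ x y).add (hℓ x y')))
      (fun k x y => tendsto_nhds_unique (hℓ x (k • y))
        (by simpa only [map_smul, inner_smul_right, smul_eq_mul, RingHom.id_apply] using (hℓ x y).const_mul _)))
    c hℓb
  have hB : ∀ x y, B x y = ℓ x y := fun x y => rfl
  refine ⟨ContinuousLinearMap.adjoint (InnerProductSpace.continuousLinearMapOfBilin B),
    fun x y => ?_⟩
  rw [ContinuousLinearMap.adjoint_inner_right, InnerProductSpace.continuousLinearMapOfBilin_apply,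
    hB]
  exact hℓ x y

omit [CompleteSpace H] in
-- On norm-bounded sets weak operator convergence implies ultraweak convergence: square-summability
-- supplies the dominating series.
theorem tendsto_tsum_inner {F : Filter ι} {T : ι → H →L[ℂ] H} {S : H →L[ℂ] H} {c : ℝ}
    (hT : ∀ i, ‖T i‖ ≤ c)
    (hS : ∀ x y, Tendsto (fun i => ⟪x, T i y⟫_ℂ) F (𝓝 ⟪x, S y⟫_ℂ))
    (ξ ζ : lp (fun _ : ℕ => H) 2) :
    Tendsto (fun i => ∑' n, ⟪ξ n, T i (ζ n)⟫_ℂ) F (𝓝 (∑' n, ⟪ξ n, S (ζ n)⟫_ℂ)) := by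
  have hsum : ∀ ξ : lp (fun _ : ℕ => H) 2, Summable fun n => ‖ξ n‖ ^ 2 := fun ξ => by
    have h1 := (lp.memℓp ξ).summable (by norm_num)
    simpa using h1
  refine tendsto_tsum_of_dominated_convergence
    (bound := fun n => c * (‖ξ n‖ ^ 2 + ‖ζ n‖ ^ 2)) (((hsum ξ).add (hsum ζ)).mul_left c)
    (fun n => hS _ _) (Eventually.of_forall fun i n => ?_)
  have hc : 0 ≤ c := (norm_nonneg _).trans (hT i)
  have h1 := (T i).le_of_opNorm_le (hT i) (ζ n)
  calc ‖⟪ξ n, T i (ζ n)⟫_ℂ‖ ≤ ‖ξ n‖ * ‖T i (ζ n)‖ := norm_inner_le_norm _ _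
    _ ≤ ‖ξ n‖ * (c * ‖ζ n‖) := mul_le_mul_of_nonneg_left h1 (norm_nonneg _)
    _ = c * (‖ξ n‖ * ‖ζ n‖) := by ring
    _ ≤ _ := mul_le_mul_of_nonneg_left (by nlinarith [sq_nonneg (‖ξ n‖ - ‖ζ n‖)]) hc

end WeakLimit

/-! ### Normality and the identification of bounded vectors -/

section VonNeumann

open Filter Topology

variable {K : Type u} [NormedAddCommGroup K] [InnerProductSpace ℂ K] [CompleteSpace K]
  {M : VonNeumannAlgebra K}

/-- By the bicommutant property it suffices to commute with `M'`, a condition that passes to weak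
limits of matrix coefficients. -/
theorem _root_.VonNeumannAlgebra.mem_of_weak_limit {ι : Type*} {F : Filter ι} [F.NeBot]
    {a : ι → M} {S : K →L[ℂ] K}
    (hS : ∀ x y, Tendsto (fun i => ⟪x, (a i : K →L[ℂ] K) y⟫_ℂ) F (𝓝 ⟪x, S y⟫_ℂ)) : S ∈ M := by
  change S ∈ (M : Set (K →L[ℂ] K))
  rw [← M.centralizer_centralizer]
  intro g hg
  ext y
  refine ext_inner_left ℂ fun x => ?_
  change ⟪x, g (S y)⟫_ℂ = ⟪x, S (g y)⟫_ℂ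
  rw [← ContinuousLinearMap.adjoint_inner_left]
  refine tendsto_nhds_unique (hS _ y) ((hS x (g y)).congr fun i => ?_)
  rw [ContinuousLinearMap.adjoint_inner_left]
  exact congrArg (fun T : K →L[ℂ] K => ⟪x, T y⟫_ℂ) (hg (a i) (a i).2)

theorem IsFaithfulNormalTrace.tendsto {τ : M →ₚ[ℂ] ℂ} (hτ : IsFaithfulNormalTrace M τ)
    {ι : Type*} {F : Filter ι} {a : ι → M} {b : M} {c : ℝ} (ha : ∀ i, ‖a i‖ ≤ c)
    (hb : ∀ x y, Tendsto (fun i => ⟪x, (a i : K →L[ℂ] K) y⟫_ℂ) F (𝓝 ⟪x, (b : K →L[ℂ] K) y⟫_ℂ)) :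
    Tendsto (fun i => τ (a i)) F (𝓝 (τ b)) := by
  have h1 : Tendsto a F (@nhds M (TopologicalSpace.induced (fun x : M => (x : K →L[ℂ] K))
      (ultraweakTopology K)) b) := by
    rw [@nhds_induced _ _ (ultraweakTopology K), tendsto_comap_iff, nhds_iInf, tendsto_iInf]
    intro ξ
    rw [nhds_iInf, tendsto_iInf]
    intro ζ
    rw [nhds_induced, tendsto_comap_iff]
    exact tendsto_tsum_inner (T := fun i => (a i : K →L[ℂ] K)) ha hb ξ ζ
  exact Tendsto.comp (@Continuous.tendsto _ _ (_) _ _ hτ.normal b) h1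

/-- The bounded vectors of `L²(M, τ)` are the vectors `aΩ`, `a ∈ M`. -/
theorem IsFaithfulNormalTrace.exists_vec_eq {τ : M →ₚ[ℂ] ℂ} (hτ : IsFaithfulNormalTrace M τ)
    (ξ : L2 τ) (c : ℝ) (hξ : ∀ b, ‖rightMul τ b ξ‖ ≤ c * ‖vec τ b‖) : ∃ a, vec τ a = ξ := by
  have hξ' : ∀ b, ‖rightMul τ b ξ‖ ≤ |c| * ‖vec τ b‖ := fun b =>
    (hξ b).trans (mul_le_mul_of_nonneg_right (le_abs_self c) (norm_nonneg _))
  obtain ⟨v, hv, hvξ⟩ := mem_closure_iff_seq_limit.mp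
    (mem_closure_vec_ball hτ.normalized hτ.tracial (abs_nonneg c) hξ')
  choose a hac hav using hv
  have hac' : ∀ k, ‖a k‖ ≤ |c| := fun k => mem_closedBall_zero_iff.mp (hac k)
  -- The vectors `aₖΩ` converge to `ξ` with `aₖ` in a fixed ball. A weak limit `S` of the `aₖ` lies
  -- in `M`, and normality gives `⟪yΩ, aₖΩ⟫ = τ(y* aₖ) → τ(y* S)`, so `SΩ = ξ`.
  let F : Ultrafilter ℕ := Ultrafilter.of atTop
  obtain ⟨S, hS⟩ := exists_weak_limit F (T := fun k => (a k : K →L[ℂ] K)) hac'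
  have hSM : S ∈ M := VonNeumannAlgebra.mem_of_weak_limit hS
  refine ⟨⟨S, hSM⟩, (isTotal_vec τ).ext_inner fun y => ?_⟩
  have h1 : Tendsto (fun k => τ (star y * a k)) F (𝓝 (τ (star y * ⟨S, hSM⟩))) := by
    refine hτ.tendsto (c := ‖star y‖ * |c|) (fun k => (norm_mul_le _ _).trans
      (mul_le_mul_of_nonneg_left (hac' k) (norm_nonneg _))) fun x z => ?_
    change Tendsto (fun k => ⟪x, star (y : K →L[ℂ] K) ((a k : K →L[ℂ] K) z)⟫_ℂ) F
      (𝓝 ⟪x, star (y : K →L[ℂ] K) (S z)⟫_ℂ)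
    rw [ContinuousLinearMap.star_eq_adjoint]
    simp only [ContinuousLinearMap.adjoint_inner_right]
    exact hS _ z
  have h2 : Tendsto (fun k => ⟪vec τ y, v k⟫_ℂ) F (𝓝 ⟪vec τ y, ξ⟫_ℂ) :=
    ((tendsto_const_nhds.inner hvξ).mono_left (Ultrafilter.of_le atTop))
  rw [inner_vec]
  refine tendsto_nhds_unique h1 (h2.congr fun k => ?_)
  rw [← hav, inner_vec]

end VonNeumann

end Subfactor

namespace Subfactor

/-! ### Application to the inclusion of von Neumann algebras and assembly -/

section Subalgebra

variable {K : Type u} [NormedAddCommGroup K] [InnerProductSpace ℂ K] [CompleteSpace K]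

/-- The von Neumann subalgebra `N`, seen as a star subalgebra of `M`. -/
def subStar (M N : VonNeumannAlgebra K) : StarSubalgebra ℂ M where
  carrier := subIn M N
  mul_mem' hx hy := mul_mem (S := VonNeumannAlgebra K) (s := N) hx hy
  add_mem' hx hy := add_mem (S := VonNeumannAlgebra K) (s := N) hx hy
  algebraMap_mem' r := N.toStarSubalgebra.algebraMap_mem r
  star_mem' hx := star_mem (S := VonNeumannAlgebra K) (s := N) hx

theorem IsFaithfulNormalTrace.isFiniteInclusion {M : VonNeumannAlgebra K} {τ : M →ₚ[ℂ] ℂ}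
    (hτ : IsFaithfulNormalTrace M τ) {B : StarSubalgebra ℂ M} {n : ℕ} {η : Fin n → M}
    (hη : IsPimsnerPopaBasis τ (B : Set M) η) : IsFiniteInclusion τ B η where
  normalized := hτ.normalized
  tracial := hτ.tracial
  faithful := hτ.faithful
  basis := hη
  bounded := hτ.exists_vec_eq

end Subalgebra

namespace IsFiniteInclusion

variable {A : Type u} [CStarAlgebra A] [PartialOrder A] [StarOrderedRing A] {τ : A →ₚ[ℂ] ℂ}
variable {B : StarSubalgebra ℂ A} {n : ℕ} {η : Fin n → A} (h : IsFiniteInclusion τ B η)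

include h

section Unitary

variable {U : Corr τ (condExp τ B) ≃ₗᵢ[ℂ] RelTensor τ (B : Set A)}
  (hU : ∀ x ξ, U (symb (corrKernel τ (condExp τ B)) x ξ) =
      tmul τ (B : Set A) ⟨vec τ x, vec_mem_boundedVectors τ B x⟩ ξ)

include hU

theorem map_corrLeft (a : A) (ξ : Corr τ (condExp τ B)) :
    U (corrLeft τ (condExp τ B) a ξ) = tensorLeft τ B a (U ξ) := by
  have key : U.toContinuousLinearEquiv.toContinuousLinearMap ∘L corrLeft τ (condExp τ B) a =
      tensorLeft τ B a ∘L U.toContinuousLinearEquiv.toContinuousLinearMap :=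
    (isTotal_symb _).ext fun p => by
      change U (corrLeft τ (condExp τ B) a (symb _ p.1 p.2)) = tensorLeft τ B a (U (symb _ p.1 p.2))
      rw [h.corrLeft_symb, hU, hU, h.tensorLeft_tmul]
  exact DFunLike.congr_fun key ξ

theorem map_corrRight (b : A) (ξ : Corr τ (condExp τ B)) :
    U (corrRight τ (condExp τ B) b ξ) = tensorRight τ B b (U ξ) := by
  have key : U.toContinuousLinearEquiv.toContinuousLinearMap ∘L corrRight τ (condExp τ B) b =
      tensorRight τ B b ∘L U.toContinuousLinearEquiv.toContinuousLinearMap :=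
    (isTotal_symb _).ext fun p => by
      change U (corrRight τ (condExp τ B) b (symb _ p.1 p.2)) =
        tensorRight τ B b (U (symb _ p.1 p.2))
      rw [h.corrRight_symb, hU, hU, h.tensorRight_tmul]
  exact DFunLike.congr_fun key ξ

theorem map_corrVec (x y : A) :
    U (corrLeft τ (condExp τ B) x (corrRight τ (condExp τ B) y (corrVec τ (condExp τ B)))) =
      tvec τ B x y := by
  rw [corrVec, corrV, h.corrRight_symb, h.corrLeft_symb, rightMul_vec h.tracial, one_mul, mul_one,
    hU]
  rfl

theorem image_corrEnd : U.conjStarAlgEquiv '' corrEnd τ (condExp τ B) =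
    bimoduleEnd (tensorLeft τ (B : Set A)) (tensorRight τ (B : Set A)) :=
  conj_image_bimoduleEnd (h.map_corrLeft hU) (h.map_corrRight hU)

end Unitary

theorem image_bimoduleEnd
    {κ : L2 (canonicalTrace τ (B : Set A) η) ≃ₗᵢ[ℂ] RelTensor τ (B : Set A)}
    (hκ : ∀ x y, κ ((delta τ (B : Set A) : ℂ) •
      vec (canonicalTrace τ (B : Set A) η) (h.jonesMul x y)) = tvec τ B x y) :
    κ.symm.conjStarAlgEquiv '' bimoduleEnd (tensorLeft τ (B : Set A)) (tensorRight τ (B : Set A)) =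
      relativeCommutant τ (B : Set A) η := by
  rw [h.relativeCommutant_eq hκ]
  refine conj_image_bimoduleEnd (fun a ξ => κ.injective ?_) (fun a ξ => κ.injective ?_)
  · rw [h.map_leftMul_incl hκ, κ.apply_symm_apply, κ.apply_symm_apply]
  · rw [h.map_rightMul_incl hκ, κ.apply_symm_apply, κ.apply_symm_apply]

theorem derivative_eq_delta_smul_fourierMultiplier {S : Set A} (hS : (B : Set A) = S) {φ : A →ₗ[ℂ] A}
    (hφ : ∃ Φ : A →CP A, Φ.toLinearMap = φ)
    (hΦ : ∀ a ∈ S, ∀ b ∈ S, ∀ x, φ (a * x * b) = a * φ x * b) :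
    Majorized φ (condExp τ S) ∧
    (∃! h, IsDerivative τ φ (condExp τ S) h) ∧
    IsFourierMultiplier τ S η φ (fourierMultiplier τ S η φ) ∧
    ∃ (ι : Corr τ (condExp τ S) ≃ₗᵢ[ℂ] RelTensor τ S)
      (κ : L2 (canonicalTrace τ S η) ≃ₗᵢ[ℂ] RelTensor τ S),
      (∀ x y, ι (corrLeft τ (condExp τ S) x (corrRight τ (condExp τ S) y
        (corrVec τ (condExp τ S)))) = tvec τ S x y) ∧
      (∀ x y, ∃ z : basicConstruction τ S,
        (z : L2 τ →L[ℂ] L2 τ) = leftMul τ x * jonesProj τ S * leftMul τ y ∧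
        κ ((delta τ S : ℂ) • vec (canonicalTrace τ S η) z) = tvec τ S x y) ∧
      ι.conjStarAlgEquiv '' corrEnd τ (condExp τ S) =
        bimoduleEnd (tensorLeft τ S) (tensorRight τ S) ∧
      κ.symm.conjStarAlgEquiv ''
          bimoduleEnd (tensorLeft τ S) (tensorRight τ S) =
        relativeCommutant τ S η ∧
      (ι.trans κ.symm).conjStarAlgEquiv (derivative τ φ (condExp τ S)) ∈
        relativeCommutant τ S η ∧
      (ι.trans κ.symm).conjStarAlgEquiv (derivative τ φ (condExp τ S)) =
        (delta τ S : ℂ) •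
          κ.symm.conjStarAlgEquiv (fourierMultiplier τ S η φ) := by
  subst hS
  obtain ⟨Φ, rfl⟩ := hφ
  refine ⟨h.majorized hΦ, h.exists_unique_isDerivative hΦ, h.isFourierMultiplier hΦ,
    h.exists_unitary.elim fun ι hι => h.exists_unitary_jonesMul.elim fun κ hκ => ⟨ι, κ, ?_⟩⟩
  have h1 := h.image_corrEnd hι
  have h2 := h.image_bimoduleEnd hκ
  exact ⟨h.map_corrVec hι, fun x y => ⟨h.jonesMul x y, rfl, hκ x y⟩, h1, h2,
    conj_trans_mem h1 h2 (h.derivative_mem_corrEnd hΦ),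
    conj_trans_eq_smul κ.symm (h.conj_derivative_eq hΦ hι)⟩

end IsFiniteInclusion

end Subfactor

end

open Subfactor

theorem mainTheorem8 {K : Type u} [NormedAddCommGroup K] [InnerProductSpace ℂ K] [CompleteSpace K]
    (M N : VonNeumannAlgebra K) (hNM : N ≤ M)
    (τ : M →ₚ[ℂ] ℂ) (hτ : IsFaithfulNormalTrace M τ)
    {n : ℕ} (η : Fin n → M) (hη : IsPimsnerPopaBasis τ (subIn M N) η)
    (Φ : M →CP M)
    (hΦ : ∀ a ∈ subIn M N, ∀ b ∈ subIn M N, ∀ x : M, Φ (a * x * b) = a * Φ x * b) :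
    -- the derivative of `Φ` with respect to `E_N` and the Fourier multiplier are well defined
    Majorized Φ.toLinearMap (condExp τ (subIn M N)) ∧
    (∃! h, IsDerivative τ Φ.toLinearMap (condExp τ (subIn M N)) h) ∧
    IsFourierMultiplier τ (subIn M N) η Φ.toLinearMap
      (fourierMultiplier τ (subIn M N) η Φ.toLinearMap) ∧
    -- the natural unitaries from `H^{E_N}` and from `L²(M₁)` onto `L²(M) ⊗_N L²(M)`
    ∃ (ι : Corr τ (condExp τ (subIn M N)) ≃ₗᵢ[ℂ] RelTensor τ (subIn M N))
      (κ : L2 (canonicalTrace τ (subIn M N) η) ≃ₗᵢ[ℂ] RelTensor τ (subIn M N)),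
      (∀ x y, ι (corrLeft τ (condExp τ (subIn M N)) x (corrRight τ (condExp τ (subIn M N)) y
        (corrVec τ (condExp τ (subIn M N))))) = tvec τ (subIn M N) x y) ∧
      (∀ x y, ∃ z : basicConstruction τ (subIn M N),
        (z : L2 τ →L[ℂ] L2 τ) = leftMul τ x * jonesProj τ (subIn M N) * leftMul τ y ∧
        κ ((delta τ (subIn M N) : ℂ) • vec (canonicalTrace τ (subIn M N) η) z) =
          tvec τ (subIn M N) x y) ∧
      -- they identify `End(_M H^{E_N}_M)`, `End(_M L²(M) ⊗_N L²(M)_M)` and `M' ∩ M₂`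
      ι.conjStarAlgEquiv '' corrEnd τ (condExp τ (subIn M N)) =
        bimoduleEnd (tensorLeft τ (subIn M N)) (tensorRight τ (subIn M N)) ∧
      κ.symm.conjStarAlgEquiv ''
          bimoduleEnd (tensorLeft τ (subIn M N)) (tensorRight τ (subIn M N)) =
        relativeCommutant τ (subIn M N) η ∧
      -- under this identification, `h_Φ = δ Φ̂` in `M' ∩ M₂`
      (ι.trans κ.symm).conjStarAlgEquiv
          (derivative τ Φ.toLinearMap (condExp τ (subIn M N))) ∈
        relativeCommutant τ (subIn M N) η ∧
      (ι.trans κ.symm).conjStarAlgEquiv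
          (derivative τ Φ.toLinearMap (condExp τ (subIn M N))) =
        (delta τ (subIn M N) : ℂ) •
          κ.symm.conjStarAlgEquiv (fourierMultiplier τ (subIn M N) η Φ.toLinearMap) := by
  have h : IsFiniteInclusion τ (subStar M N) η := hτ.isFiniteInclusion hη
  have hS : ((subStar M N : StarSubalgebra ℂ M) : Set M) = subIn M N := rfl
  have hφ : ∃ Ψ : M →CP M, Ψ.toLinearMap = Φ.toLinearMap := ⟨Φ, rfl⟩
  exact h.derivative_eq_delta_smul_fourierMultiplier hS hφ hΦ
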